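/- Let $V$ be a finite set with $n$ elements. An ice quiver $Q$ on $V$ is given by a skew-symmetric integer matrix $(Q_{ij})_{i,j\in V}$ (with $Q_{ij}$ the signed number of arrows from $i$ to $j$; no loops or directed 2-cycles) and a subset of frozen vertices; the other vertices are called mutable. A seed $(Q,\mathbf a)$ is an ice quiver $Q$ on $V$ with a cluster $\mathbf a=(a_i)_{i\in V}$ of algebraically independent elements of $K=\mathbb{Q}(x_1,\dots,x_n)$. Mutation of $(Q,\mathbf a)$ at a mutable vertex $k$ replaces $a_k$ by $\big(\prod_{Q_{kj}>0}a_j^{Q_{kj}}+\prod_{Q_{kj}<0}a_j^{-Q_{kj}}\big)a_k^{-1}$, replaces $Q_{ij}$ by $-Q_{ij}$ if $k\in\{i,j\}$ and by $Q_{ij}+\tfrac12\big(|Q_{ik}|Q_{kj}+Q_{ik}|Q_{kj}|\big)$ otherwise, and changes nothing else. The cluster algebra $\mathcal A=\mathcal A(Q,\mathbf a)\subset K$ is the subring generated by the entries of the clusters of all seeds that are mutation equivalent to $(Q,\mathbf a)$ (the seeds of $\mathcal A$) and by the inverses of the frozen variables. It is acyclic if it has a seed whose quiver has no directed cycle of mutable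 vertices. A cluster localization of $\mathcal A$ is a cluster algebra $\mathcal A'$ obtained from a seed of $\mathcal A$ by declaring some set of mutable vertices frozen, such that $\mathcal A\subseteq\mathcal A'$; then $\operatorname{Spec}\mathcal A'$ is an open subscheme of $\operatorname{Spec}\mathcal A$. The algebra $\mathcal A$ is locally acyclic if $\operatorname{Spec}\mathcal A$ is covered by the spectra of finitely many acyclic cluster localizations of $\mathcal A$. For a seed $(Q',\mathbf a')$ of $\mathcal A$ let $L_{\mathbf a'}=\mathbb Z[a_1'^{\pm1},\dots,a_n'^{\pm1}]\subset K$; it contains $\mathcal A$, and $\operatorname{Spec}L_{\mathbf a'}\subset\operatorname{Spec}\mathcal A$ is the cluster torus of $\mathbf a'$. The Weil–Petersson form $\omega_{WP}$ is the 2-form on the union of all cluster tori which on the cluster torus of each seed $(Q',\mathbf a')$ is $$\omega_{WP}=\sum_{i,j\in V}Q'_{ij}\,\frac{da'_i\wedge da'_j}{a'_i\,a'_j}\in\textstyle\bigwedge^2_{L_{\mathbf a'}}\Omega_{L_{\mathbf a'}/\mathbb Z}.$$ **Theorem.** If $\mathcal A$ is locally acyclic, then $\omega_{WP}$ extends to a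 Kähler 2-form on $\operatorname{Spec}\mathcal A$: there is an element $\eta\in\bigwedge^2_{\mathcal A}\Omega_{\mathcal A/\mathbb Z}$ such that, for every seed $(Q',\mathbf a')$ of $\mathcal A$, the ring $\mathcal A$ is contained in $L_{\mathbf a'}$ and the image of $\eta$ in $\bigwedge^2_{L_{\mathbf a'}}\Omega_{L_{\mathbf a'}/\mathbb Z}$ is $\omega_{WP}$. -/

import Mathlib

open scoped KaehlerDifferential

noncomputable section

/-! ### Kähler 2-forms -/

/-- Kähler differential 2-forms on `Spec R` over `ℤ`: the elements of `⋀²_R Ω_{R/ℤ}`. -/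
abbrev TwoForm (R : Type*) [CommRing R] : Type _ := ⋀[R]^2 Ω[R⁄ℤ]

namespace TwoForm

/-- The 2-form `db ∧ dc`. -/
def dd {R : Type*} [CommRing R] (b c : R) : TwoForm R :=
  exteriorPower.ιMulti R 2 ![KaehlerDifferential.D ℤ R b, KaehlerDifferential.D ℤ R c]

/-- Pullback of Kähler differentials along a ring homomorphism `f : R → S`,
that is, the map `Ω_{R/ℤ} → Ω_{S/ℤ}`, `r db ↦ f(r) d(f b)`. -/
def pullbackOne {R S : Type*} [CommRing R] [CommRing S] (f : R →+* S) :
    Ω[R⁄ℤ] →ₛₗ[f] Ω[S⁄ℤ] :=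
  letI : Algebra R S := f.toAlgebra
  { toFun := KaehlerDifferential.map ℤ ℤ R S
    map_add' := map_add _
    map_smul' := fun r x => by
      rw [map_smul]
      exact algebra_compatible_smul S r _ }

/-- Pullback of 2-forms along the morphism `Spec S → Spec R` dual to `f : R → S`,
as an additive map; see `pullback_smul` and `pullback_dd`. -/
def pullback {R S : Type*} [CommRing R] [CommRing S] (f : R →+* S) :
    TwoForm R →+ TwoForm S :=
  letI : Module R (TwoForm S) := Module.compHom (TwoForm S) f
  LinearMap.toAddMonoidHom (exteriorPower.alternatingMapLinearEquiv
    { toFun := fun v => exteriorPower.ιMulti S 2 (fun i => pullbackOne f (v i))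
      map_update_add' := fun v i x y => by
        have h : ∀ z, (fun j => pullbackOne f (Function.update v i z j)) =
            Function.update (fun j => pullbackOne f (v j)) i (pullbackOne f z) := by
          intro z; ext1 j; by_cases hj : j = i
          · subst hj; simp
          · simp [hj]
        simp only [h, map_add, AlternatingMap.map_update_add]
      map_update_smul' := fun v i r x => by
        have h : ∀ z, (fun j => pullbackOne f (Function.update v i z j)) =
            Function.update (fun j => pullbackOne f (v j)) i (pullbackOne f z) := by
          intro z; ext1 j; by_cases hj : j = i
          · subst hj; simp
          · simp [hj]
        simp only [h, map_smulₛₗ, AlternatingMap.map_update_smul]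
        rfl
      map_eq_zero_of_eq' := fun v i j hij hne =>
        AlternatingMap.map_eq_zero_of_eq _ _ (by simp only [hij]) hne })

theorem pullback_smul {R S : Type*} [CommRing R] [CommRing S] (f : R →+* S)
    (r : R) (ω : TwoForm R) : pullback f (r • ω) = f r • pullback f ω :=
  let : Module R (TwoForm S) := Module.compHom (TwoForm S) f
  map_smul (exteriorPower.alternatingMapLinearEquiv _) r ω

theorem pullback_dd {R S : Type*} [CommRing R] [CommRing S] (f : R →+* S) (b c : R) :
    pullback f (dd b c) = dd (f b) (f c) := by
  let : Module R (TwoForm S) := Module.compHom (TwoForm S) f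
  let : Algebra R S := f.toAlgebra
  have h : ∀ x : R, pullbackOne f (KaehlerDifferential.D ℤ R x) =
      KaehlerDifferential.D ℤ S (f x) := fun x => KaehlerDifferential.map_D ℤ ℤ R S x
  refine (exteriorPower.alternatingMapLinearEquiv_apply_ιMulti _ _).trans ?_
  change exteriorPower.ιMulti S 2 _ = exteriorPower.ιMulti S 2 _
  congr 1
  ext1 i
  fin_cases i
  · exact h b
  · exact h c

end TwoForm

/-! ### Ice quivers and seeds -/

/-- An ice quiver without loops or directed 2-cycles on the vertex set `V`, encoded by its
skew-symmetric integer matrix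
`arrows i j = #(arrows from i to j) - #(arrows from j to i)`, and its set of frozen vertices. -/
@[ext]
structure IceQuiver (V : Type*) where
  arrows : V → V → ℤ
  skew : ∀ i j, arrows i j = -arrows j i
  frozen : Finset V

namespace IceQuiver

variable {V : Type*} [DecidableEq V]

/-- Mutation of an ice quiver at the vertex `k`. (The numerator below is always even.) -/
def mutate (Q : IceQuiver V) (k : V) : IceQuiver V where
  arrows i j :=
    if i = k ∨ j = k then -Q.arrows i j
    else Q.arrows i j + (|Q.arrows i k| * Q.arrows k j + Q.arrows i k * |Q.arrows k j|) / 2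
  skew i j := by
    by_cases h : i = k ∨ j = k
    · rw [if_pos h, if_pos h.symm, Q.skew i j]
    · rw [if_neg h, if_neg (fun h' => h h'.symm)]
      have hd : (2 : ℤ) ∣ |Q.arrows i k| * Q.arrows k j + Q.arrows i k * |Q.arrows k j| := by
        rcases abs_choice (Q.arrows i k) with h1 | h1 <;>
          rcases abs_choice (Q.arrows k j) with h2 | h2 <;> rw [h1, h2]
        · exact ⟨Q.arrows i k * Q.arrows k j, by ring⟩
        · exact ⟨0, by ring⟩
        · exact ⟨0, by ring⟩
        · exact ⟨-(Q.arrows i k * Q.arrows k j), by ring⟩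
      rw [Q.skew i j, Q.skew j k, Q.skew k i, abs_neg, abs_neg,
        show |Q.arrows k j| * -Q.arrows i k + -Q.arrows k j * |Q.arrows i k| =
          -(|Q.arrows i k| * Q.arrows k j + Q.arrows i k * |Q.arrows k j|) by ring,
        Int.neg_ediv_of_dvd hd]
      ring
  frozen := Q.frozen

/-- Freezing the vertices in `S`. -/
def freeze (Q : IceQuiver V) (S : Finset V) : IceQuiver V where
  arrows := Q.arrows
  skew := Q.skew
  frozen := Q.frozen ∪ S

/-- There is an arrow from `i` to `j` and both vertices are mutable. -/
def MutableArrow (Q : IceQuiver V) (i j : V) : Prop :=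
  i ∉ Q.frozen ∧ j ∉ Q.frozen ∧ 0 < Q.arrows i j

/-- An ice quiver is acyclic if its mutable part has no directed cycle. -/
def IsAcyclic (Q : IceQuiver V) : Prop :=
  ∀ v, ¬ Relation.TransGen Q.MutableArrow v v

end IceQuiver

/-- A seed with cluster variables in the field `K`. -/
structure Seed (V K : Type*) where
  quiver : IceQuiver V
  cluster : V → K

namespace Seed

variable {V K : Type*} [Fintype V] [DecidableEq V] [Field K]

/-- Mutation of a seed at the vertex `k`. -/
def mutate (s : Seed V K) (k : V) : Seed V K where
  quiver := s.quiver.mutate k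
  cluster i :=
    if i = k then
      (∏ j, s.cluster j ^ (s.quiver.arrows k j).toNat +
        ∏ j, s.cluster j ^ (-s.quiver.arrows k j).toNat) * (s.cluster k)⁻¹
    else s.cluster i

/-- `t` is obtained from `s` by a finite sequence of mutations at mutable vertices. -/
def MutationEquivalent (s t : Seed V K) : Prop :=
  Relation.ReflTransGen (fun u w : Seed V K => ∃ k ∉ u.quiver.frozen, w = u.mutate k) s t

/-- The cluster algebra of a seed: the subring of `K` generated by the cluster variables of all
mutation equivalent seeds (frozen variables included) and the inverses of the frozen variables. -/
def clusterAlgebra (s : Seed V K) : Subring K :=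
  Subring.closure
    ({x | ∃ t, s.MutationEquivalent t ∧ ∃ v, x = t.cluster v} ∪
      {x | ∃ v ∈ s.quiver.frozen, x = (s.cluster v)⁻¹})

/-- Freezing the vertices in `S`, keeping the cluster. -/
def freeze (s : Seed V K) (S : Finset V) : Seed V K where
  quiver := s.quiver.freeze S
  cluster := s.cluster

/-- The cluster algebra of the seed `s` is acyclic: it has an acyclic seed. -/
def IsAcyclic (s : Seed V K) : Prop :=
  ∃ t, s.MutationEquivalent t ∧ t.quiver.IsAcyclic

/-- The cluster algebra of `s'` is a cluster localization of that of `s`: `s'` is the freezing, at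
some set of mutable vertices, of a seed of the cluster algebra of `s`, and the cluster algebra of
`s` is contained in that of `s'`. The open subscheme `Spec` of the latter is a cluster chart. -/
def IsClusterLocalization (s s' : Seed V K) : Prop :=
  (∃ t, s.MutationEquivalent t ∧ ∃ S : Finset V, Disjoint S t.quiver.frozen ∧ s' = t.freeze S) ∧
    s.clusterAlgebra ≤ s'.clusterAlgebra

/-- The cluster algebra of `s` is locally acyclic: its spectrum is the union of the (images of the)
spectra of finitely many acyclic cluster localizations. -/
def IsLocallyAcyclic (s : Seed V K) : Prop :=
  ∃ C : Set (Seed V K), C.Finite ∧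
    (∀ s' ∈ C, s.IsClusterLocalization s' ∧ s'.IsAcyclic) ∧
    ∀ P : PrimeSpectrum s.clusterAlgebra, ∃ s' ∈ C, ∃ h : s.clusterAlgebra ≤ s'.clusterAlgebra,
      P ∈ Set.range (PrimeSpectrum.comap (Subring.inclusion h))

/-- The Laurent ring `ℤ[a₁^±¹, …, aₙ^±¹] ⊆ K` of the cluster of `s`, the coordinate ring of the
cluster torus of `s`. -/
def laurentRing (s : Seed V K) : Subring K :=
  Subring.closure (Set.range s.cluster ∪ Set.range fun v => (s.cluster v)⁻¹)

/-- The cluster variable at `v` as an element of the Laurent ring. -/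
def laurentVar (s : Seed V K) (v : V) : s.laurentRing :=
  ⟨s.cluster v, Subring.subset_closure (Or.inl ⟨v, rfl⟩)⟩

/-- The inverse of the cluster variable at `v` as an element of the Laurent ring. -/
def laurentInv (s : Seed V K) (v : V) : s.laurentRing :=
  ⟨(s.cluster v)⁻¹, Subring.subset_closure (Or.inr ⟨v, rfl⟩)⟩

/-- The Weil-Petersson form on the cluster torus of `s`,
`∑_{i,j} Q_{ij} (da_i ∧ da_j) / (a_i a_j)`. -/
def weilPetersson (s : Seed V K) : TwoForm s.laurentRing :=
  ∑ i, ∑ j, (s.quiver.arrows i j) •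
    ((s.laurentInv i * s.laurentInv j) • TwoForm.dd (s.laurentVar i) (s.laurentVar j))

end Seed

/-- The field `ℚ(x_v : v ∈ V)` of rational functions. -/
abbrev RationalFunctions (V : Type*) : Type _ := FractionRing (MvPolynomial V ℚ)

end

open scoped KaehlerDifferential

noncomputable section

/-! ### Generalities on 2-forms -/

/-! Over the field `K` the formula for the Weil–Petersson form gives the same 2-form for every seed.
Under mutation at `k`, `dlog a_k` changes by integral combinations of the `dlog a_j` plus a
nonconstant multiple of `κ = ∑ Q_kj dlog a_j`; in the alternating sum that multiple is paired only
with `κ`, so it disappears (`IceQuiver.sum_mutate_arrows_smul`). It remains to show that this form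
comes from the cluster algebra, and this is local on the spectrum
(`TwoForm.mem_formsOver_of_forall_prime`).

At a prime of an acyclic chart, take an acyclic seed and the set `S` of vertices whose variables lie
in the prime. Acyclicity and the exchange relations exclude arrows inside `S`. For `i ∈ S` with
exchange relation `a_i b = p + q`, the monomials `p` and `q` are therefore units nearby. The `i`-th
row of the form is `dlog a_i ∧ dlog (p/q)`, and `p/q = a_i (b/q) - 1` rewrites it as `(q/p) da_i ∧
d(b/q)`, which has no pole. All other terms involve only invertible variables.

To compare with a cluster torus one needs that its 2-forms embed into those of `K`, because the
differentials of every cluster are independent, and that the cluster algebra lies in its Laurent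
ring. This Laurent phenomenon goes by induction on the number of mutations. An auxiliary vertex `y`
joined only to the first vertex `i` makes the new variable `z` at `i` linear in `y`, hence prime.
The Laurent rings after the mutations `i` and `i, j, i` then meet inside the original one, since `z`
is coprime to the other new variables; this is tested at a single rational point. Finally `y` is set
to 1. -/

/-- The elements whose differential lies in a given submodule of the Kähler differentials. -/
def KaehlerDifferential.subringOfMem {R : Type*} [CommRing R] (N : Submodule R Ω[R⁄ℤ]) :
    Subring R where
  carrier := {x | KaehlerDifferential.D ℤ R x ∈ N}
  zero_mem' := by simp
  one_mem' := by simp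
  add_mem' := fun {x y} hx hy => by
    simp only [Set.mem_ofPred_eq, map_add] at *
    exact N.add_mem hx hy
  neg_mem' := fun {x} hx => by
    simp only [Set.mem_ofPred_eq, map_neg] at *
    exact N.neg_mem hx
  mul_mem' := fun {x y} hx hy => by
    simp only [Set.mem_ofPred_eq, Derivation.leibniz] at *
    exact N.add_mem (N.smul_mem _ hy) (N.smul_mem _ hx)

namespace KaehlerDifferential

section

variable {R : Type*} [CommRing R] {N : Submodule R Ω[R⁄ℤ]}

theorem mem_subringOfMem {x : R} : x ∈ subringOfMem N ↔ D ℤ R x ∈ N := Iff.rfl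

theorem mem_subringOfMem_of_mul_eq_one {x y : R} (hx : x ∈ subringOfMem N) (hxy : x * y = 1) :
    y ∈ subringOfMem N := by
  rw [mem_subringOfMem] at *
  have h : D ℤ R (x * y) = 0 := by simp [hxy]
  rw [Derivation.leibniz] at h
  have h' : D ℤ R y = -((y * y) • D ℤ R x) := by
    have := congrArg (fun z => y • z) h
    simp only [smul_add, smul_smul, smul_zero] at this
    rw [mul_comm y x, hxy, one_smul] at this
    exact eq_neg_of_add_eq_zero_left this
  rw [h']
  exact N.neg_mem (N.smul_mem _ hx)

/-- Clears the denominator of a differential when `f` and `f ^ m * b` lie in a subring. The extra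
factor `f` replaces the coefficient `m f^(m-1) b` of `df`, which may lie outside the subring, by `m
f^m b`. -/
theorem pow_succ_smul_D (f b : R) (m : ℕ) :
    f ^ (m + 1) • D ℤ R b = f • D ℤ R (f ^ m * b) - (m * (f ^ m * b)) • D ℤ R f := by
  rcases m with _ | m
  · simp
  · simp only [Derivation.leibniz, Derivation.leibniz_pow, Nat.add_sub_cancel]
    simp only [smul_add, smul_smul, ← Nat.cast_smul_eq_nsmul R]
    match_scalars <;> ring

end

end KaehlerDifferential

namespace TwoForm

open KaehlerDifferential

theorem update_pair_zero {M : Type*} (α β x : M) :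
    Function.update ![α, β] 0 x = ![x, β] := by
  ext i; fin_cases i <;> rfl

theorem update_pair_one {M : Type*} (α β x : M) :
    Function.update ![α, β] 1 x = ![α, x] := by
  ext i; fin_cases i <;> rfl

/-- The wedge product of two Kähler differentials, as a bilinear map. -/
def wedge (R : Type*) [CommRing R] : Ω[R⁄ℤ] →ₗ[R] Ω[R⁄ℤ] →ₗ[R] TwoForm R :=
  LinearMap.mk₂ R (fun α β => exteriorPower.ιMulti R 2 ![α, β])
    (fun α α' β => by
      simpa only [update_pair_zero] using
        (exteriorPower.ιMulti R 2).map_update_add ![α, β] 0 α α')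
    (fun c α β => by
      simpa only [update_pair_zero] using
        (exteriorPower.ιMulti R 2).map_update_smul ![α, β] 0 c α)
    (fun α β β' => by
      simpa only [update_pair_one] using
        (exteriorPower.ιMulti R 2).map_update_add ![α, β] 1 β β')
    (fun c α β => by
      simpa only [update_pair_one] using
        (exteriorPower.ιMulti R 2).map_update_smul ![α, β] 1 c β)

section Wedge

variable {R : Type*} [CommRing R]

theorem wedge_apply (α β : Ω[R⁄ℤ]) : wedge R α β = exteriorPower.ιMulti R 2 ![α, β] := rfl

theorem dd_eq_wedge (b c : R) : dd b c = wedge R (D ℤ R b) (D ℤ R c) := rfl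

theorem wedge_self (α : Ω[R⁄ℤ]) : wedge R α α = 0 :=
  (exteriorPower.ιMulti R 2).map_eq_zero_of_eq ![α, α] (i := 0) (j := 1) rfl (by decide)

theorem wedge_swap (α β : Ω[R⁄ℤ]) : wedge R α β = -wedge R β α := by
  have h := wedge_self (α + β)
  simp only [map_add, LinearMap.add_apply, wedge_self, zero_add, add_zero] at h
  exact eq_neg_of_add_eq_zero_right h

theorem wedge_mem_span {s : Set Ω[R⁄ℤ]} (hs : Submodule.span R s = ⊤) (η : TwoForm R) :
    η ∈ Submodule.span R {ω | ∃ α ∈ s, ∃ β ∈ s, ω = wedge R α β} := by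
  have h := exteriorPower.ιMulti_span_of_span R 2 (M := Ω[R⁄ℤ]) hs
  have hη : η ∈ (⊤ : Submodule R (TwoForm R)) := trivial
  rw [← h] at hη
  refine Submodule.span_mono ?_ hη
  rintro _ ⟨v, hv, rfl⟩
  refine ⟨v 0, hv ⟨0, rfl⟩, v 1, hv ⟨1, rfl⟩, ?_⟩
  rw [wedge_apply]
  congr 1
  ext i
  fin_cases i <;> rfl

/-- 2-forms are sums of forms `r db ∧ dc`. -/
theorem induction_on {p : TwoForm R → Prop} (η : TwoForm R) (h0 : p 0)
    (hadd : ∀ ω ω', p ω → p ω' → p (ω + ω')) (hdd : ∀ r b c : R, p (r • dd b c)) : p η := by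
  refine Submodule.closure_induction (p := fun ω _ => p ω) h0 (fun _ _ _ _ => hadd _ _) ?_
    (wedge_mem_span (KaehlerDifferential.span_range_derivation ℤ R) η)
  rintro r _ ⟨_, ⟨b, rfl⟩, _, ⟨c, rfl⟩, rfl⟩
  exact hdd r b c

end Wedge

theorem pullback_comp {R S T : Type*} [CommRing R] [CommRing S] [CommRing T]
    (f : R →+* S) (g : S →+* T) (η : TwoForm R) :
    pullback g (pullback f η) = pullback (g.comp f) η := by
  induction η using induction_on with
  | h0 => simp
  | hadd ω ω' h h' => simp only [map_add, h, h']
  | hdd r b c => simp only [pullback_smul, pullback_dd, RingHom.comp_apply]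

/-! ### 2-forms on a field which come from a subring -/

section Field

variable {K : Type*} [Field K]

/-- The 2-forms over `K` which are pullbacks of 2-forms over the subring `R`. -/
def formsOver (R : Subring K) : AddSubgroup (TwoForm K) := (pullback R.subtype).range

theorem smul_mem_formsOver {R : Subring K} {r : K} (hr : r ∈ R) {ω : TwoForm K} (hω : ω ∈ formsOver R) :
    r • ω ∈ formsOver R := by
  obtain ⟨η, rfl⟩ := hω
  exact ⟨(⟨r, hr⟩ : R) • η, pullback_smul _ _ _⟩

theorem dd_mem_formsOver {R : Subring K} {b c : K} (hb : b ∈ R) (hc : c ∈ R) : dd b c ∈ formsOver R :=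
  ⟨dd ⟨b, hb⟩ ⟨c, hc⟩, pullback_dd _ _ _⟩

/-- The localization of a subring of a field at the powers of `h`. -/
def _root_.Subring.away (R : Subring K) (h : K) (hh : h ∈ R) : Subring K where
  carrier := {x | ∃ n : ℕ, h ^ n * x ∈ R}
  zero_mem' := ⟨0, by simp [R.zero_mem]⟩
  one_mem' := ⟨0, by simp [R.one_mem]⟩
  add_mem' := by
    rintro x y ⟨n, hn⟩ ⟨m, hm⟩
    refine ⟨n + m, ?_⟩
    have : h ^ (n + m) * (x + y) = h ^ m * (h ^ n * x) + h ^ n * (h ^ m * y) := by ring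
    rw [this]
    exact R.add_mem (R.mul_mem (R.pow_mem hh _) hn) (R.mul_mem (R.pow_mem hh _) hm)
  neg_mem' := by
    rintro x ⟨n, hn⟩
    exact ⟨n, by rw [mul_neg]; exact R.neg_mem hn⟩
  mul_mem' := by
    rintro x y ⟨n, hn⟩ ⟨m, hm⟩
    refine ⟨n + m, ?_⟩
    have : h ^ (n + m) * (x * y) = (h ^ n * x) * (h ^ m * y) := by ring
    rw [this]
    exact R.mul_mem hn hm

theorem _root_.Subring.mem_away {R : Subring K} {h : K} {hh : h ∈ R} {x : K} :
    x ∈ R.away h hh ↔ ∃ n : ℕ, h ^ n * x ∈ R := Iff.rfl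

theorem _root_.Subring.le_away {R : Subring K} {h : K} (hh : h ∈ R) : R ≤ R.away h hh :=
  fun x hx => ⟨0, by simpa using hx⟩

/-- A 2-form has finitely many denominators. For `r db ∧ dc` the coefficient costs `h ^ k`, and each
differential one power more than its argument, by `pow_succ_smul_D`. -/
theorem exists_pow_smul_mem_formsOver {R : Subring K} {h : K} {hh : h ∈ R} {ω : TwoForm K}
    (hω : ω ∈ formsOver (R.away h hh)) : ∃ n : ℕ, h ^ n • ω ∈ formsOver R := by
  obtain ⟨η, rfl⟩ := hω
  induction η using induction_on with
  | h0 => exact ⟨0, by simp [(formsOver R).zero_mem]⟩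
  | hadd ω ω' h1 h2 =>
    obtain ⟨n, hn⟩ := h1
    obtain ⟨m, hm⟩ := h2
    refine ⟨n + m, ?_⟩
    rw [map_add, smul_add]
    refine (formsOver R).add_mem ?_ ?_
    · rw [pow_add, mul_comm, mul_smul]
      exact smul_mem_formsOver (R.pow_mem hh _) hn
    · rw [pow_add, mul_smul]
      exact smul_mem_formsOver (R.pow_mem hh _) hm
  | hdd r b c =>
    obtain ⟨r, k, hk⟩ := r
    obtain ⟨b, m, hm⟩ := b
    obtain ⟨c, n, hn⟩ := c
    refine ⟨k + ((m + 1) + (n + 1)), ?_⟩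
    rw [pullback_smul, pullback_dd]
    simp only [Subring.subtype_apply]
    have key : h ^ (k + ((m + 1) + (n + 1))) • r • dd b c =
        (h ^ k * r) • wedge K (h ^ (m + 1) • D ℤ K b) (h ^ (n + 1) • D ℤ K c) := by
      rw [map_smul, map_smul, LinearMap.smul_apply, ← dd_eq_wedge]
      simp only [smul_smul]
      congr 1
      ring
    rw [key, pow_succ_smul_D, pow_succ_smul_D]
    refine smul_mem_formsOver hk ?_
    have hcast : ∀ j : ℕ, (j : K) ∈ R := fun j => natCast_mem R j
    simp only [map_sub, LinearMap.sub_apply, map_smul, LinearMap.smul_apply, smul_sub,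
      ← dd_eq_wedge]
    refine (formsOver R).sub_mem ((formsOver R).sub_mem ?_ ?_) ((formsOver R).sub_mem ?_ ?_) <;>
    refine smul_mem_formsOver ?_ (smul_mem_formsOver ?_ (dd_mem_formsOver ?_ ?_)) <;>
    first
      | assumption
      | exact R.mul_mem (hcast _) (by assumption)

/-- Being the pullback of a 2-form over the subring `R` is a local property on `Spec R`. -/
theorem mem_formsOver_of_forall_prime {R : Subring K} {ω : TwoForm K}
    (hω : ∀ P : PrimeSpectrum R, ∃ h : R, h ∉ P.asIdeal ∧ ω ∈ formsOver (R.away h h.2)) :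
    ω ∈ formsOver R := by
  -- The ideal of denominators of `ω`. As `ω` is given globally over `K`, nothing has to be glued:
  -- it is enough that `I` lies in no maximal ideal.
  let I : Ideal R :=
    { carrier := {r | (r : K) • ω ∈ formsOver R}
      zero_mem' := by simp [(formsOver R).zero_mem]
      add_mem' := fun {a b} ha hb => by
        simp only [Set.mem_ofPred_eq, Subring.coe_add, add_smul] at *
        exact (formsOver R).add_mem ha hb
      smul_mem' := fun a b hb => by
        simp only [Set.mem_ofPred_eq, smul_eq_mul, Subring.coe_mul, mul_smul] at *
        exact smul_mem_formsOver a.2 hb }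
  have hI : I = ⊤ := by
    by_contra hne
    obtain ⟨P, hP, hle⟩ := Ideal.exists_le_maximal I hne
    obtain ⟨h, hhP, hh⟩ := hω ⟨P, hP.isPrime⟩
    obtain ⟨n, hn⟩ := exists_pow_smul_mem_formsOver hh
    have hmem : h ^ n ∈ I := by
      change ((h ^ n : R) : K) • ω ∈ formsOver R
      simpa using hn
    exact hhP (hP.isPrime.mem_of_pow_mem n (hle hmem))
  have h1 : (1 : R) ∈ I := hI ▸ Submodule.mem_top
  have h2 : ((1 : R) : K) • ω ∈ formsOver R := h1
  simpa using h2

end Field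

/-- A symmetric combination of wedge products vanishes. -/
theorem sum_smul_wedge_eq_zero {R ι : Type*} [CommRing R] [Fintype ι] (r : ι → ι → R)
    (hr : ∀ i j, r i j = r j i) (α : ι → Ω[R⁄ℤ]) :
    ∑ i, ∑ j, r i j • wedge R (α i) (α j) = 0 := by
  classical
  rw [← Fintype.sum_prod_type' (f := fun i j => r i j • wedge R (α i) (α j))]
  refine Finset.sum_involution (fun p _ => p.swap) ?_ ?_ (by simp) (by simp)
  · rintro ⟨i, j⟩ -
    simp only [Prod.swap, hr j i]
    rw [wedge_swap (α j), smul_neg, add_neg_cancel]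
  · rintro ⟨i, j⟩ - h1 h2
    simp only [Prod.swap, Prod.mk.injEq] at h2
    exact h1 (by simp only [h2.1, wedge_self, smul_zero])

/-- The 2-forms `α i ∧ α j` over a field satisfy no relations besides antisymmetry. -/
theorem coeff_symm_of_sum_smul_wedge_eq_zero {K ι : Type*} [Field K] [Fintype ι]
    {α : ι → Ω[K⁄ℤ]} (hα : LinearIndependent K α) (r : ι → ι → K)
    (h : ∑ i, ∑ j, r i j • wedge K (α i) (α j) = 0) (k l : ι) : r k l = r l k := by
  classical
  -- Coordinate functionals on the span of the `α i`, extended to all differentials. The 2×2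
  -- determinant of those for `k` and `l` reads off `r k l - r l k`.
  have hdual : ∀ k, ∃ f : Ω[K⁄ℤ] →ₗ[K] K, ∀ i, f (α i) = if i = k then 1 else 0 := by
    intro k
    obtain ⟨f, hf⟩ := LinearMap.exists_extend
      ((Finsupp.lapply k).comp (hα.repr : Submodule.span K (Set.range α) →ₗ[K] ι →₀ K))
    refine ⟨f, fun i => ?_⟩
    have := congrArg (fun g => g ⟨α i, Submodule.subset_span ⟨i, rfl⟩⟩) hf
    simp only [LinearMap.comp_apply, Submodule.subtype_apply, Finsupp.lapply_apply] at this
    rw [this, hα.repr_eq_single i _ rfl, Finsupp.single_apply]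
  obtain ⟨f, hf⟩ := hdual k
  obtain ⟨g, hg⟩ := hdual l
  let A : Ω[K⁄ℤ] [⋀^Fin 2]→ₗ[K] K :=
    (Matrix.detRowAlternating (R := K) (n := Fin 2)).compLinearMap (LinearMap.pi ![f, g])
  have hA : ∀ β γ, exteriorPower.alternatingMapLinearEquiv A (wedge K β γ) =
      f β * g γ - g β * f γ := by
    intro β γ
    rw [wedge_apply, exteriorPower.alternatingMapLinearEquiv_apply_ιMulti]
    simp only [A, AlternatingMap.compLinearMap_apply]
    exact Matrix.det_fin_two _
  have := congrArg (exteriorPower.alternatingMapLinearEquiv A) h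
  simp only [map_sum, map_smul, hA, hf, hg, map_zero, smul_eq_mul] at this
  have e1 : ∀ i j, r i j * ((if i = k then (1 : K) else 0) * (if j = l then 1 else 0) -
      (if i = l then 1 else 0) * (if j = k then 1 else 0)) =
      (if i = k then (if j = l then r i j else 0) else 0) -
      (if i = l then (if j = k then r i j else 0) else 0) := by
    intro i j
    split_ifs <;> simp
  simp only [e1, Finset.sum_sub_distrib, Finset.sum_ite_irrel, Finset.sum_const_zero,
    Finset.sum_ite_eq', Finset.mem_univ, if_true] at this
  exact sub_eq_zero.mp this

end TwoForm

/-! ### Linear independence of the differentials of a cluster -/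

/-- In characteristic zero, the differentials of a transcendence basis are independent. -/
theorem IsTranscendenceBasis.linearIndependent_D {V K : Type*} [Field K] [Algebra ℚ K]
    {a : V → K} (ha : IsTranscendenceBasis ℚ a) :
    LinearIndependent K fun v => KaehlerDifferential.D ℤ K (a v) := by
  let φ : MvPolynomial V ℚ →ₐ[ℚ] K := MvPolynomial.aeval a
  have hφ : Function.Injective φ := ha.1
  let _ : Algebra (MvPolynomial V ℚ) K := φ.toAlgebra
  have _ : IsScalarTower ℚ (MvPolynomial V ℚ) K := .of_algebraMap_eq' φ.comp_algebraMap.symm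
  have _ : FaithfulSMul (MvPolynomial V ℚ) K := (faithfulSMul_iff_algebraMap_injective _ _).mpr hφ
  have hX : ∀ v, algebraMap (MvPolynomial V ℚ) K (MvPolynomial.X v) = a v :=
    fun v => MvPolynomial.aeval_X a v
  let F := FractionRing (MvPolynomial V ℚ)
  let _ : Algebra F K := FractionRing.liftAlgebra _ K
  have _ : IsScalarTower (MvPolynomial V ℚ) F K := FractionRing.isScalarTower_liftAlgebra _ K
  have _ : Algebra.IsAlgebraic (MvPolynomial V ℚ) K :=
    ha.isAlgebraic_iff.mpr fun v => by rw [← hX v]; exact isAlgebraic_algebraMap _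
  have _ : Algebra.IsAlgebraic F K :=
    (IsFractionRing.comap_isAlgebraic_iff (A := MvPolynomial V ℚ)).mp inferInstance
  -- Both steps from the polynomial ring to `K` are formally étale: a localization, then an
  -- algebraic extension in characteristic zero. Hence `Ω[K⁄ℚ]` is a base change with basis the `d(a
  -- v)`.
  have _ : Algebra.FormallyEtale F K := Algebra.FormallyEtale.of_isSeparable F K
  have _ : Algebra.FormallyEtale (MvPolynomial V ℚ) F :=
    Algebra.FormallyEtale.of_isLocalization (nonZeroDivisors _)
  have _ : Algebra.FormallyEtale (MvPolynomial V ℚ) K := .comp _ F K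
  let b := ((KaehlerDifferential.mvPolynomialBasis ℚ V).baseChange K).map
    (KaehlerDifferential.tensorKaehlerEquivOfFormallyEtale ℚ (MvPolynomial V ℚ) K)
  have hb : ∀ v, b v = KaehlerDifferential.D ℚ K (a v) := by
    intro v
    simp [b, Module.Basis.map_apply, Module.Basis.baseChange_apply,
      KaehlerDifferential.mvPolynomialBasis_apply, hX]
  have h : LinearIndependent K fun v => KaehlerDifferential.D ℚ K (a v) := by
    simpa only [← hb] using b.linearIndependent
  refine LinearIndependent.of_comp (KaehlerDifferential.map ℤ ℚ K K) ?_
  convert h using 1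
  ext v
  simp

theorem AlgebraicIndependent.isTranscendenceBasis_rationalFunctions {V : Type*} [Finite V]
    {a : V → RationalFunctions V} (ha : AlgebraicIndependent ℚ a) :
    IsTranscendenceBasis ℚ a := by
  refine ha.isTranscendenceBasis_of_trdeg_le_of_finite ?_
  have _ : Algebra.IsAlgebraic (MvPolynomial V ℚ) (RationalFunctions V) :=
    IsLocalization.isAlgebraic (RationalFunctions V) (nonZeroDivisors (MvPolynomial V ℚ))
  have h := (IsTranscendenceBasis.mvPolynomial V ℚ).algebraMap_comp (A := RationalFunctions V)
  rw [h.cardinalMk_eq_trdeg]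

/-- A family of vectors is independent if its span contains as many independent vectors. -/
theorem LinearIndependent.of_span_le {ι K M : Type*} [Fintype ι] [Field K] [AddCommGroup M]
    [Module K M] {v w : ι → M} (hv : LinearIndependent K v)
    (h : Submodule.span K (Set.range v) ≤ Submodule.span K (Set.range w)) :
    LinearIndependent K w := by
  rw [linearIndependent_iff_card_le_finrank_span, Set.finrank]
  have := linearIndependent_iff_card_le_finrank_span.mp hv
  have _ : Module.Finite K (Submodule.span K (Set.range w)) :=
    FiniteDimensional.span_of_finite K (Set.finite_range w)
  exact this.trans (Submodule.finrank_mono h)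

/-! ### Forms on a cluster torus embed into forms over the field -/

namespace TwoForm

open KaehlerDifferential

/-- If a domain is generated by units of a field with independent differentials and their inverses,
then its 2-forms embed into those of the field. -/
theorem pullback_subtype_injective {V K : Type*} [Fintype V] [Field K] {a : V → K}
    (h0 : ∀ v, a v ≠ 0) (ha : LinearIndependent K fun v => D ℤ K (a v)) {L : Subring K}
    (hL : L = Subring.closure (Set.range a ∪ Set.range fun v => (a v)⁻¹)) :
    Function.Injective (pullback L.subtype) := by
  have hmem : ∀ v, a v ∈ L := fun v => hL ▸ Subring.subset_closure (Or.inl ⟨v, rfl⟩)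
  have hinv : ∀ v, (a v)⁻¹ ∈ L := fun v => hL ▸ Subring.subset_closure (Or.inr ⟨v, rfl⟩)
  let x : V → L := fun v => ⟨a v, hmem v⟩
  let N : Submodule L Ω[L⁄ℤ] := Submodule.span L (Set.range fun v => D ℤ L (x v))
  have hx : ∀ v, x v ∈ subringOfMem N := fun v => Submodule.subset_span ⟨v, rfl⟩
  have hsub : ∀ y (hy : y ∈ L), (⟨y, hy⟩ : L) ∈ subringOfMem N := by
    have hle : L ≤ (subringOfMem N).map L.subtype := by
      conv_lhs => rw [hL]
      rw [Subring.closure_le]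
      rintro _ (⟨v, rfl⟩ | ⟨v, rfl⟩)
      · exact ⟨x v, hx v, rfl⟩
      · refine ⟨⟨(a v)⁻¹, hinv v⟩, mem_subringOfMem_of_mul_eq_one (hx v) ?_, rfl⟩
        ext
        exact mul_inv_cancel₀ (h0 v)
    intro y hy
    obtain ⟨z, hz, rfl⟩ := hle hy
    exact hz
  have hN : N = ⊤ := by
    rw [eq_top_iff, ← KaehlerDifferential.span_range_derivation ℤ L, Submodule.span_le]
    rintro _ ⟨y, rfl⟩
    exact hsub y.1 y.2
  rw [injective_iff_map_eq_zero]
  intro η hη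
  obtain ⟨r, hr⟩ : ∃ r : V → V → L,
      η = ∑ i, ∑ j, r i j • wedge L (D ℤ L (x i)) (D ℤ L (x j)) := by
    have := wedge_mem_span hN η
    clear hη
    induction this using Submodule.closure_induction with
    | zero => exact ⟨0, by simp⟩
    | add η η' _ _ h h' =>
      obtain ⟨r, rfl⟩ := h
      obtain ⟨r', rfl⟩ := h'
      exact ⟨r + r', by simp only [Pi.add_apply, add_smul, Finset.sum_add_distrib]⟩
    | smul_mem c η h =>
      classical
      obtain ⟨_, ⟨k, rfl⟩, _, ⟨l, rfl⟩, rfl⟩ := h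
      refine ⟨fun i j => if i = k then (if j = l then c else 0) else 0, ?_⟩
      simp [ite_smul, Finset.sum_ite_irrel]
  -- The coefficients matter only up to a symmetric matrix. Vanishing over `K` forces symmetry, and
  -- a symmetric matrix gives zero already over `L`.
  have hsymm : ∀ i j, r i j = r j i := by
    intro k l
    ext
    refine coeff_symm_of_sum_smul_wedge_eq_zero ha (fun i j => (r i j : K)) ?_ k l
    rw [← hη, hr]
    simp only [map_sum, pullback_smul, ← dd_eq_wedge, pullback_dd]
    rfl
  rw [hr]
  exact sum_smul_wedge_eq_zero r hsymm _

end TwoForm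

/-! ### Mutations of quivers and seeds -/

namespace IceQuiver

variable {V : Type*} (Q : IceQuiver V)

@[simp]
theorem arrows_self (k : V) : Q.arrows k k = 0 := by
  have := Q.skew k k
  omega

variable [DecidableEq V]

theorem mutate_arrows (k i j : V) : (Q.mutate k).arrows i j =
    if i = k ∨ j = k then -Q.arrows i j
    else Q.arrows i j + (|Q.arrows i k| * Q.arrows k j + Q.arrows i k * |Q.arrows k j|) / 2 := rfl

theorem mutate_arrows_left (k j : V) : (Q.mutate k).arrows k j = -Q.arrows k j := by
  simp [mutate_arrows]

theorem mutate_arrows_right (k i : V) :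
    (Q.mutate k).arrows i k = Q.arrows k i := by
  rw [(Q.mutate k).skew, IceQuiver.mutate_arrows_left, neg_neg]

theorem _root_.Int.toNat_sub_toNat_neg_eq (a : ℤ) : ((a.toNat : ℤ) - ((-a).toNat : ℤ)) = a := by
  omega

theorem _root_.Int.abs_eq_toNat_add (a : ℤ) : |a| = (a.toNat : ℤ) + ((-a).toNat : ℤ) := by
  rcases abs_cases a with h | h <;> omega

/-- The mutation rule in terms of positive and negative parts of the arrows at `k`. -/
theorem mutate_arrows_eq (k i j : V) : (Q.mutate k).arrows i j =
    Q.arrows i j + ((-Q.arrows k i).toNat * (Q.arrows k j).toNat -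
      (Q.arrows k i).toNat * (-Q.arrows k j).toNat : ℤ) -
      2 * ((if i = k then Q.arrows k j else 0) + (if j = k then Q.arrows i k else 0)) := by
  rw [mutate_arrows]
  by_cases hi : i = k
  · subst hi
    by_cases hj : j = i
    · subst hj; simp
    · simp [hj]; ring
  · by_cases hj : j = k
    · subst hj; simp [hi]; ring
    · simp only [hi, hj, or_self, if_false]
      rw [Q.skew i k]
      have h1 := Int.toNat_sub_toNat_neg_eq (Q.arrows k i)
      have h2 := Int.toNat_sub_toNat_neg_eq (Q.arrows k j)
      rw [abs_neg, Int.abs_eq_toNat_add (Q.arrows k i), Int.abs_eq_toNat_add (Q.arrows k j)]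
      set a : ℤ := ((Q.arrows k i).toNat : ℤ)
      set b : ℤ := ((-Q.arrows k i).toNat : ℤ)
      set c : ℤ := ((Q.arrows k j).toNat : ℤ)
      set d : ℤ := ((-Q.arrows k j).toNat : ℤ)
      have : (a + b) * Q.arrows k j + -Q.arrows k i * (c + d) = 2 * (b * c - a * d) := by
        rw [← h1, ← h2]; ring
      rw [this, Int.mul_ediv_cancel_left _ two_ne_zero]
      ring

theorem mutate_mutate (k : V) : (Q.mutate k).mutate k = Q := by
  ext i j
  · rw [mutate_arrows_eq, mutate_arrows_eq, mutate_arrows_left, mutate_arrows_left]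
    have h : (Q.mutate k).arrows i k = - Q.arrows i k := by simp [mutate_arrows]
    rw [h]
    split_ifs <;> simp <;> ring
  · rfl

end IceQuiver

namespace Seed

variable {V K : Type*} [Fintype V] [DecidableEq V] [Field K] (s : Seed V K)

/-- The product of the cluster variables at the heads of the arrows out of `k`. -/
def posProd (k : V) : K := ∏ j, s.cluster j ^ (s.quiver.arrows k j).toNat

/-- The product of the cluster variables at the tails of the arrows into `k`. -/
def negProd (k : V) : K := ∏ j, s.cluster j ^ (-s.quiver.arrows k j).toNat

@[simp]
theorem mutate_cluster_self (k : V) :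
    (s.mutate k).cluster k = (s.posProd k + s.negProd k) * (s.cluster k)⁻¹ := by
  simp [mutate, posProd, negProd]

theorem mutate_cluster_of_ne {k i : V} (h : i ≠ k) : (s.mutate k).cluster i = s.cluster i := by
  simp [mutate, h]

@[simp]
theorem mutate_quiver (k : V) : (s.mutate k).quiver = s.quiver.mutate k := rfl

theorem mutate_posProd (k : V) : (s.mutate k).posProd k = s.negProd k := by
  refine Finset.prod_congr rfl fun j _ => ?_
  rw [mutate_quiver, IceQuiver.mutate_arrows_left]
  by_cases hj : j = k
  · subst hj; simp
  · rw [mutate_cluster_of_ne _ hj]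

theorem mutate_negProd (k : V) : (s.mutate k).negProd k = s.posProd k := by
  refine Finset.prod_congr rfl fun j _ => ?_
  rw [mutate_quiver, IceQuiver.mutate_arrows_left, neg_neg]
  by_cases hj : j = k
  · subst hj; simp
  · rw [mutate_cluster_of_ne _ hj]

variable {s} in
theorem mutate_mutate {k : V} (h : s.cluster k ≠ 0) (h' : (s.mutate k).cluster k ≠ 0) :
    (s.mutate k).mutate k = s := by
  have hc : ((s.mutate k).mutate k).cluster = s.cluster := by
    ext i
    by_cases hi : i = k
    · subst hi
      rw [mutate_cluster_self, mutate_posProd, mutate_negProd, mutate_cluster_self, add_comm]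
      rw [mutate_cluster_self] at h'
      have := left_ne_zero_of_mul h'
      field_simp
    · rw [mutate_cluster_of_ne _ hi, mutate_cluster_of_ne _ hi]
  have hq : ((s.mutate k).mutate k).quiver = s.quiver := s.quiver.mutate_mutate k
  cases s
  exact congrArg₂ Seed.mk hq hc

/-- The seed obtained by mutating successively at the vertices of a list. -/
def mutateList (l : List V) : Seed V K := l.foldl mutate s

@[simp]
theorem mutateList_cons (k : V) (l : List V) :
    s.mutateList (k :: l) = (s.mutate k).mutateList l := rfl

/-- All cluster variables which can be reached by mutation are nonzero. -/
def Nondegenerate : Prop := ∀ l v, (s.mutateList l).cluster v ≠ 0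

namespace Nondegenerate

variable {s}

theorem mutate (hs : s.Nondegenerate) (k : V) : (s.mutate k).Nondegenerate :=
  fun l v => hs (k :: l) v

theorem ne_zero (hs : s.Nondegenerate) (v : V) : s.cluster v ≠ 0 := hs [] v

theorem mutate_mutate (hs : s.Nondegenerate) (k : V) : (s.mutate k).mutate k = s :=
  Seed.mutate_mutate (hs.ne_zero k) ((hs.mutate k).ne_zero k)

theorem posProd_ne_zero (hs : s.Nondegenerate) (k : V) : s.posProd k ≠ 0 :=
  Finset.prod_ne_zero_iff.mpr fun j _ => pow_ne_zero _ (hs.ne_zero j)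

theorem negProd_ne_zero (hs : s.Nondegenerate) (k : V) : s.negProd k ≠ 0 :=
  Finset.prod_ne_zero_iff.mpr fun j _ => pow_ne_zero _ (hs.ne_zero j)

end Nondegenerate

variable {s}

/-- A seed is nondegenerate if its cluster lies in a subsemifield without zero. -/
theorem nondegenerate_of_mem {T : Set K} (hadd : ∀ x ∈ T, ∀ y ∈ T, x + y ∈ T)
    (hmul : ∀ x ∈ T, ∀ y ∈ T, x * y ∈ T) (hinv : ∀ x ∈ T, x⁻¹ ∈ T) (h1 : 1 ∈ T) (h0 : 0 ∉ T)
    (hs : ∀ v, s.cluster v ∈ T) : s.Nondegenerate := by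
  have hmut : ∀ t : Seed V K, (∀ v, t.cluster v ∈ T) → ∀ k v, (t.mutate k).cluster v ∈ T := by
    intro t ht k v
    have hprod : ∀ n : V → ℕ, ∏ j, t.cluster j ^ n j ∈ T := by
      intro n
      let M : Submonoid K :=
        { carrier := T, mul_mem' := fun {a b} ha hb => hmul a ha b hb, one_mem' := h1 }
      exact M.prod_mem fun j _ => M.pow_mem (ht j) _
    by_cases hv : v = k
    · subst hv
      rw [mutate_cluster_self]
      exact hmul _ (hadd _ (hprod _) _ (hprod _)) _ (hinv _ (ht v))
    · rw [mutate_cluster_of_ne _ hv]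
      exact ht v
  have hlist : ∀ (l : List V) (t : Seed V K), (∀ v, t.cluster v ∈ T) →
      ∀ v, (t.mutateList l).cluster v ∈ T := by
    intro l
    induction l with
    | nil => exact fun t ht => ht
    | cons k l ih => exact fun t ht => ih _ (hmut t ht k)
  intro l v h
  exact h0 (h ▸ hlist l s hs v)

/-- Quotients of polynomials that are positive at `(1, …, 1)` are nonzero and closed under sums,
products and inverses, the only operations used by mutation. -/
theorem nondegenerate_of_algebraicIndependent (hs : AlgebraicIndependent ℤ s.cluster) :
    s.Nondegenerate := by
  let ev : MvPolynomial V ℤ →+* ℤ := (MvPolynomial.aeval fun _ => (1 : ℤ)).toRingHom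
  let φ : MvPolynomial V ℤ →+* K := (MvPolynomial.aeval s.cluster).toRingHom
  have hφ : ∀ f, 0 < ev f → φ f ≠ 0 := by
    intro f hf h
    have : f = 0 := hs (h.trans (map_zero φ).symm)
    simp [this] at hf
  refine nondegenerate_of_mem (T := {x | ∃ f g, 0 < ev f ∧ 0 < ev g ∧ x = φ f / φ g})
    ?_ ?_ ?_ ?_ ?_ ?_
  · rintro _ ⟨f, g, hf, hg, rfl⟩ _ ⟨f', g', hf', hg', rfl⟩
    refine ⟨f * g' + g * f', g * g', ?_, ?_, ?_⟩
    · rw [map_add, map_mul, map_mul]; positivity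
    · rw [map_mul]; positivity
    · rw [div_add_div _ _ (hφ g hg) (hφ g' hg')]; simp
  · rintro _ ⟨f, g, hf, hg, rfl⟩ _ ⟨f', g', hf', hg', rfl⟩
    refine ⟨f * f', g * g', ?_, ?_, ?_⟩
    · rw [map_mul]; positivity
    · rw [map_mul]; positivity
    · rw [div_mul_div_comm]; simp
  · rintro _ ⟨f, g, hf, hg, rfl⟩
    exact ⟨g, f, hg, hf, inv_div _ _⟩
  · exact ⟨1, 1, by simp, by simp, by simp⟩
  · rintro ⟨f, g, hf, hg, h⟩
    exact div_ne_zero (hφ f hf) (hφ g hg) h.symm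
  · intro v
    refine ⟨MvPolynomial.X v, 1, ?_, by simp, ?_⟩
    · simp [ev]
    · simp [φ]

end Seed

/-! ### The Weil–Petersson form over the field of rational functions -/

/-- The logarithmic differential `dx / x`. -/
def dlog {K : Type*} [Field K] (x : K) : Ω[K⁄ℤ] := x⁻¹ • KaehlerDifferential.D ℤ K x

section dlog

variable {K : Type*} [Field K]

theorem smul_dlog {x : K} (hx : x ≠ 0) : x • dlog x = KaehlerDifferential.D ℤ K x := by
  rw [dlog, smul_smul, mul_inv_cancel₀ hx, one_smul]

theorem dlog_mul {x y : K} (hx : x ≠ 0) (hy : y ≠ 0) : dlog (x * y) = dlog x + dlog y := by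
  simp only [dlog, Derivation.leibniz, smul_add, smul_smul]
  rw [add_comm]
  congr 2 <;> field_simp

theorem dlog_one : dlog (1 : K) = 0 := by simp [dlog]

theorem dlog_inv {x : K} (hx : x ≠ 0) : dlog x⁻¹ = -dlog x := by
  have := dlog_mul hx (inv_ne_zero hx)
  rw [mul_inv_cancel₀ hx, dlog_one] at this
  exact (neg_eq_of_add_eq_zero_right this.symm).symm

theorem dlog_pow {x : K} (hx : x ≠ 0) (n : ℕ) : dlog (x ^ n) = (n : ℤ) • dlog x := by
  induction n with
  | zero => simp [dlog_one]
  | succ n ih =>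
    rw [pow_succ, dlog_mul (pow_ne_zero _ hx) hx, ih]
    push_cast
    rw [add_smul, one_smul]

theorem dlog_prod_pow {ι : Type*} (s : Finset ι) {x : ι → K} (hx : ∀ i, x i ≠ 0) (n : ι → ℕ) :
    dlog (∏ i ∈ s, x i ^ n i) = ∑ i ∈ s, (n i : ℤ) • dlog (x i) := by
  classical
  induction s using Finset.induction_on with
  | empty => simp [dlog_one]
  | insert i s hi ih =>
    rw [Finset.prod_insert hi, Finset.sum_insert hi, dlog_mul (pow_ne_zero _ (hx i)), ih,
      dlog_pow (hx i)]
    exact Finset.prod_ne_zero_iff.mpr fun j _ => pow_ne_zero _ (hx j)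

/-- Uses `dlog (p + q) = (p dlog p + q dlog q)/(p + q)`, arranged so that the nonconstant
coefficient multiplies `dlog p - dlog q`, which is `κ` for an exchange relation. -/
theorem dlog_mul_add {a b p q : K} (ha : a ≠ 0) (hb : b ≠ 0) (hp : p ≠ 0) (hq : q ≠ 0)
    (h : a * b = p + q) :
    dlog b = -dlog a + dlog q + (p / (p + q)) • (dlog p - dlog q) := by
  have h0 : p + q ≠ 0 := h ▸ mul_ne_zero ha hb
  have h1 : dlog (p + q) = dlog a + dlog b := h ▸ dlog_mul ha hb
  have h2 : dlog (p + q) = (p + q)⁻¹ • (p • dlog p + q • dlog q) := by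
    rw [smul_dlog hp, smul_dlog hq, ← map_add]
    rfl
  rw [eq_sub_of_add_eq' h1.symm, h2]
  match_scalars <;> field_simp
  ring

end dlog

namespace IceQuiver

variable {V K M N : Type*} [Fintype V] [Field K] [AddCommGroup M] [Module K M]
  [AddCommGroup N] [Module K N] (Q : IceQuiver V) (B : M →ₗ[K] M →ₗ[K] N)

theorem sum_sum_mul_smul (x y : V → ℤ) (d : V → M) :
    ∑ i, ∑ j, (x i * y j) • B (d i) (d j) = B (∑ i, x i • d i) (∑ j, y j • d j) := by
  simp only [map_sum, map_zsmul, LinearMap.sum_apply, LinearMap.smul_apply, Finset.smul_sum,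
    mul_smul]
  rw [Finset.sum_comm]
  exact Finset.sum_congr rfl fun j _ => Finset.sum_congr rfl fun i _ => smul_comm _ _ _

variable [DecidableEq V]

variable {B} in
/-- The quadratic form of a quiver is invariant under mutation. -/
theorem sum_mutate_arrows_smul (hB : ∀ x, B x x = 0) (d d' : V → M) (k : V) (c : K)
    (hd : ∀ i ≠ k, d' i = d i)
    (hk : d' k = -d k + ∑ j, ((-Q.arrows k j).toNat : ℤ) • d j + c • ∑ j, Q.arrows k j • d j) :
    ∑ i, ∑ j, (Q.mutate k).arrows i j • B (d' i) (d' j) =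
      ∑ i, ∑ j, Q.arrows i j • B (d i) (d j) := by
  have hswap : ∀ x y, B x y = -B y x := by
    intro x y
    have h := hB (x + y)
    simp only [map_add, LinearMap.add_apply, hB, zero_add, add_zero] at h
    exact eq_neg_of_add_eq_zero_right h
  set P := ∑ j, ((Q.arrows k j).toNat : ℤ) • d j with hP
  set R := ∑ j, ((-Q.arrows k j).toNat : ℤ) • d j with hR
  set κ := ∑ j, Q.arrows k j • d j with hκ
  have hPR : P - R = κ := by
    rw [hP, hR, ← Finset.sum_sub_distrib]
    refine Finset.sum_congr rfl fun j _ => ?_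
    rw [← sub_smul, Int.toNat_sub_toNat_neg_eq]
  obtain ⟨e, he⟩ : ∃ e, e = d' k - d k := ⟨_, rfl⟩
  have hd' : ∀ i, d' i = d i + if i = k then e else 0 := by
    intro i
    by_cases hi : i = k
    · subst hi; simp [he]
    · simp [hi, hd]
  have hskew : ∑ i, Q.arrows i k • d i = -κ := by
    rw [hκ, ← Finset.sum_neg_distrib]
    exact Finset.sum_congr rfl fun i _ => by rw [Q.skew i k, neg_smul]
  have hmain : ∑ i, ∑ j, (Q.mutate k).arrows i j • B (d i) (d j) =
      ∑ i, ∑ j, Q.arrows i j • B (d i) (d j) + (B R P - B P R) -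
        (2 : ℤ) • (B (d k) κ - B κ (d k)) := by
    have e1 : ∑ i, ∑ j, (if i = k then Q.arrows k j else 0) • B (d i) (d j) = B (d k) κ := by
      rw [Finset.sum_eq_single k (by simp +contextual) (by simp)]
      simp [hκ, map_sum]
    have e2 : ∑ i, ∑ j, (if j = k then Q.arrows i k else 0) • B (d i) (d j) = -B κ (d k) := by
      rw [Finset.sum_comm, Finset.sum_eq_single k (by simp +contextual) (by simp)]
      rw [← LinearMap.neg_apply, ← map_neg, ← hskew]
      simp [map_sum, LinearMap.sum_apply]
    simp only [mutate_arrows_eq, sub_smul, add_smul, mul_smul (2 : ℤ), Finset.sum_sub_distrib,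
      Finset.sum_add_distrib, ← Finset.smul_sum, e1, e2, sum_sum_mul_smul, ← hP, ← hR]
    abel
  have e1 : ∑ j, (Q.mutate k).arrows k j • B e (d j) = -B e κ := by
    simp [mutate_arrows_left, hκ, map_sum]
  have e2 : ∑ i, (Q.mutate k).arrows i k • B (d i) e = B κ e := by
    have : ∀ i, (Q.mutate k).arrows i k = Q.arrows k i := by
      intro i; rw [(Q.mutate k).skew, mutate_arrows_left, neg_neg]
    simp [this, hκ, map_sum, LinearMap.sum_apply]
  -- There is no `B e e` term, since the quiver has no loop at `k`.
  have hexp : ∑ i, ∑ j, (Q.mutate k).arrows i j • B (d' i) (d' j) =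
      ∑ i, ∑ j, (Q.mutate k).arrows i j • B (d i) (d j) +
        ∑ j, (Q.mutate k).arrows k j • B e (d j) +
        ∑ i, (Q.mutate k).arrows i k • B (d i) e := by
    have : ∀ i j, (Q.mutate k).arrows i j • B (d' i) (d' j) =
        (Q.mutate k).arrows i j • B (d i) (d j) +
        (if i = k then (Q.mutate k).arrows k j • B e (d j) else 0) +
        (if j = k then (Q.mutate k).arrows i k • B (d i) e else 0) := by
      intro i j
      rw [hd', hd']
      by_cases hi : i = k
      · subst hi
        by_cases hj : j = i
        · subst hj; simp
        · simp [hj]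
      · by_cases hj : j = k
        · subst hj; simp [hi]
        · simp [hi, hj]
    simp only [this, Finset.sum_add_distrib]
    congr 1
    · congr 1
      rw [Finset.sum_eq_single k (by simp +contextual) (by simp)]
      simp
    · rw [Finset.sum_comm, Finset.sum_eq_single k (by simp +contextual) (by simp)]
      simp
  have heκ : e = -(2 : ℤ) • d k + R + c • κ := by
    rw [he, hk]; module
  have hPeq : P = κ + R := by rw [← hPR]; abel
  -- Together these give `-2 B e κ`: the part `c • κ` of `e` contributes nothing, and the parts
  -- along `d k` and `R` cancel the corrections in `hmain`.
  rw [hexp, hmain, e1, e2, hswap κ e, hswap κ (d k), heκ, hPeq]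
  simp only [map_add, map_smul, map_zsmul, LinearMap.add_apply, LinearMap.smul_apply, hB,
    hswap κ R, smul_zero]
  module

end IceQuiver

namespace Seed

open KaehlerDifferential

variable {V K : Type*} [Fintype V] [Field K] {s : Seed V K}

/-- The Weil–Petersson form as a 2-form over the ambient field. -/
def weilPeterssonField (s : Seed V K) : TwoForm K :=
  ∑ i, ∑ j, s.quiver.arrows i j •
    TwoForm.wedge K (dlog (s.cluster i)) (dlog (s.cluster j))

theorem pullback_weilPetersson (s : Seed V K) :
    TwoForm.pullback s.laurentRing.subtype s.weilPetersson = s.weilPeterssonField := by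
  simp only [weilPetersson, weilPeterssonField, map_sum, map_zsmul, TwoForm.pullback_smul,
    TwoForm.pullback_dd, dlog, map_smul, LinearMap.smul_apply, map_mul,
    ← TwoForm.dd_eq_wedge, smul_smul]
  refine Finset.sum_congr rfl fun i _ => Finset.sum_congr rfl fun j _ => ?_
  rw [mul_comm]
  rfl

variable [DecidableEq V]

theorem dlog_posProd (hs : s.Nondegenerate) (k : V) :
    dlog (s.posProd k) = ∑ j, ((s.quiver.arrows k j).toNat : ℤ) • dlog (s.cluster j) :=
  dlog_prod_pow _ hs.ne_zero _

theorem dlog_negProd (hs : s.Nondegenerate) (k : V) :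
    dlog (s.negProd k) = ∑ j, ((-s.quiver.arrows k j).toNat : ℤ) • dlog (s.cluster j) :=
  dlog_prod_pow _ hs.ne_zero _

theorem dlog_posProd_sub_dlog_negProd (hs : s.Nondegenerate) (k : V) :
    dlog (s.posProd k) - dlog (s.negProd k) =
      ∑ j, s.quiver.arrows k j • dlog (s.cluster j) := by
  rw [dlog_posProd hs, dlog_negProd hs, ← Finset.sum_sub_distrib]
  refine Finset.sum_congr rfl fun j _ => ?_
  rw [← sub_smul, Int.toNat_sub_toNat_neg_eq]

theorem cluster_mul_mutate_cluster (hs : s.Nondegenerate) (k : V) :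
    s.cluster k * (s.mutate k).cluster k = s.posProd k + s.negProd k := by
  rw [mutate_cluster_self, mul_comm, inv_mul_cancel_right₀ (hs.ne_zero k)]

theorem weilPeterssonField_mutate (hs : s.Nondegenerate) (k : V) :
    (s.mutate k).weilPeterssonField = s.weilPeterssonField := by
  refine s.quiver.sum_mutate_arrows_smul TwoForm.wedge_self (fun i => dlog (s.cluster i)) _ k
    (s.posProd k / (s.posProd k + s.negProd k)) (fun i hi => ?_) ?_
  · rw [mutate_cluster_of_ne _ hi]
  · rw [← dlog_negProd hs, ← dlog_posProd_sub_dlog_negProd hs]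
    exact dlog_mul_add (hs.ne_zero k) ((hs.mutate k).ne_zero k) (hs.posProd_ne_zero k)
      (hs.negProd_ne_zero k) (cluster_mul_mutate_cluster hs k)

/-- Mutating back expresses the old variables rationally in the new ones, so the new differentials
span the old, and there are equally many. -/
theorem linearIndependent_D_mutate (hs : s.Nondegenerate)
    (h : LinearIndependent K fun v => D ℤ K (s.cluster v)) (k : V) :
    LinearIndependent K fun v => D ℤ K ((s.mutate k).cluster v) := by
  refine h.of_span_le ?_
  set N := Submodule.span K (Set.range fun v => D ℤ K ((s.mutate k).cluster v)) with hN
  have hmem : ∀ v, (s.mutate k).cluster v ∈ subringOfMem N :=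
    fun v => Submodule.subset_span ⟨v, rfl⟩
  rw [Submodule.span_le]
  rintro _ ⟨v, rfl⟩
  change s.cluster v ∈ subringOfMem N
  by_cases hv : v = k
  · subst hv
    have hprod : ∀ n : V → ℕ, ∏ j, (s.mutate v).cluster j ^ n j ∈ subringOfMem N :=
      fun n => Subring.prod_mem _ fun j _ => Subring.pow_mem _ (hmem j) _
    have hv := hs.mutate_mutate v
    have hcl : s.cluster v = ((s.mutate v).mutate v).cluster v := by rw [hv]
    rw [hcl, mutate_cluster_self]
    refine Subring.mul_mem _ (Subring.add_mem _ (hprod _) (hprod _)) ?_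
    exact mem_subringOfMem_of_mul_eq_one (hmem v) (mul_inv_cancel₀ ((hs.mutate v).ne_zero v))
  · rw [← mutate_cluster_of_ne s hv]
    exact hmem v

theorem MutationEquivalent.nondegenerate {t : Seed V K} (h : s.MutationEquivalent t)
    (hs : s.Nondegenerate) : t.Nondegenerate := by
  induction h with
  | refl => exact hs
  | tail _ h ih => obtain ⟨k, -, rfl⟩ := h; exact ih.mutate k

theorem MutationEquivalent.weilPeterssonField_eq {t : Seed V K} (h : s.MutationEquivalent t)
    (hs : s.Nondegenerate) : t.weilPeterssonField = s.weilPeterssonField := by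
  induction h with
  | refl => rfl
  | tail h' h ih =>
    obtain ⟨k, -, rfl⟩ := h
    rw [weilPeterssonField_mutate (MutationEquivalent.nondegenerate h' hs), ih]

theorem MutationEquivalent.linearIndependent_D {t : Seed V K} (h : s.MutationEquivalent t)
    (hs : s.Nondegenerate) (hD : LinearIndependent K fun v => D ℤ K (s.cluster v)) :
    LinearIndependent K fun v => D ℤ K (t.cluster v) := by
  induction h with
  | refl => exact hD
  | tail h' h ih =>
    obtain ⟨k, -, rfl⟩ := h
    exact linearIndependent_D_mutate (MutationEquivalent.nondegenerate h' hs) ih k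

theorem MutationEquivalent.exists_mutateList {t : Seed V K} (h : s.MutationEquivalent t) :
    ∃ l, t = s.mutateList l := by
  induction h using Relation.ReflTransGen.head_induction_on with
  | refl => exact ⟨[], rfl⟩
  | head h _ ih =>
    obtain ⟨k, -, rfl⟩ := h
    obtain ⟨l, rfl⟩ := ih
    exact ⟨k :: l, rfl⟩

theorem MutationEquivalent.frozen_eq {t : Seed V K} (h : s.MutationEquivalent t) :
    t.quiver.frozen = s.quiver.frozen := by
  induction h with
  | refl => rfl
  | tail _ h ih => obtain ⟨k, -, rfl⟩ := h; exact ih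

theorem MutationEquivalent.cluster_eq {t : Seed V K} (h : s.MutationEquivalent t) {v : V}
    (hv : v ∈ s.quiver.frozen) : t.cluster v = s.cluster v := by
  induction h with
  | refl => rfl
  | tail h' h ih =>
    obtain ⟨k, hk, rfl⟩ := h
    rw [mutate_cluster_of_ne, ih]
    rintro rfl
    exact hk (MutationEquivalent.frozen_eq h' ▸ hv)

end Seed

/-! ### Laurent monomials and specializations -/

namespace Laurent

section Monomial

variable {W K : Type*} [Field K]

/-- The subring generated by a family of elements of a field and their inverses. -/
def ring (a : W → K) : Subring K :=
  Subring.closure (Set.range a ∪ Set.range fun w => (a w)⁻¹)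

theorem mem_ring (a : W → K) (w : W) : a w ∈ ring a := Subring.subset_closure (Or.inl ⟨w, rfl⟩)

theorem inv_mem_ring (a : W → K) (w : W) : (a w)⁻¹ ∈ ring a :=
  Subring.subset_closure (Or.inr ⟨w, rfl⟩)

variable [Fintype W]

/-- The monomial with the given exponents. -/
def mon (a : W → K) (n : W → ℕ) : K := ∏ w, a w ^ n w

theorem mon_mem_ring (a : W → K) (n : W → ℕ) : mon a n ∈ ring a :=
  Subring.prod_mem _ fun w _ => Subring.pow_mem _ (mem_ring a w) _

theorem inv_mon_mem_ring (a : W → K) (n : W → ℕ) : (mon a n)⁻¹ ∈ ring a := by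
  rw [mon, ← Finset.prod_inv_distrib]
  refine Subring.prod_mem _ fun w _ => ?_
  rw [← inv_pow]
  exact Subring.pow_mem _ (inv_mem_ring a w) _

theorem mon_mul (a : W → K) (n m : W → ℕ) : mon a n * mon a m = mon a (n + m) := by
  simp only [mon, Pi.add_apply, pow_add, Finset.prod_mul_distrib]

theorem mon_pow (a : W → K) (n : W → ℕ) (b : ℕ) : mon a n ^ b = mon a (b • n) := by
  simp only [mon, Pi.smul_apply, smul_eq_mul, ← Finset.prod_pow, ← pow_mul, mul_comm]

theorem mon_single [DecidableEq W] (a : W → K) (w : W) (b : ℕ) :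
    mon a (Pi.single w b) = a w ^ b := by
  rw [mon, Finset.prod_eq_single w (fun v _ hv => by simp [hv]) (by simp)]
  simp

theorem mon_eq_of_forall_ne [DecidableEq W] {a a' : W → K} {k : W} (h : ∀ w ≠ k, a' w = a w)
    (n : W → ℕ) : mon a' n = a' k ^ n k * mon a (Function.update n k 0) := by
  rw [mon, mon, ← Finset.mul_prod_erase _ _ (Finset.mem_univ k),
    ← Finset.mul_prod_erase (a := k) Finset.univ (fun w => a w ^ _) (Finset.mem_univ k)]
  simp only [Function.update_self, pow_zero, one_mul]
  congr 1
  refine Finset.prod_congr rfl fun w hw => ?_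
  rw [h w (Finset.ne_of_mem_erase hw), Function.update_of_ne (Finset.ne_of_mem_erase hw)]

end Monomial

section Specialization

open MvPolynomial

variable {W K F : Type*} [Field K] [Field F]

/-- The element `x'` is a value of the rational function `x` of the family `a` at the point `c`. -/
def Specializes (a : W → K) (c : W → F) (x : K) (x' : F) : Prop :=
  ∃ f g : MvPolynomial W ℤ, aeval c g ≠ 0 ∧ x * aeval a g = aeval a f ∧
    x' * aeval c g = aeval c f

namespace Specializes

variable {a : W → K} {c : W → F} {x y : K} {x' y' : F}

/-- By independence, two fractions representing `x` agree after cross-multiplication as polynomials,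
and both denominators are nonzero at `c`. -/
theorem unique (ha : AlgebraicIndependent ℤ a) {x'' : F} (h : Specializes a c x x')
    (h' : Specializes a c x x'') : x' = x'' := by
  obtain ⟨f, g, hg, h1, h2⟩ := h
  obtain ⟨f', g', hg', h1', h2'⟩ := h'
  have hfg : f * g' = f' * g := by
    apply ha
    rw [map_mul, map_mul, ← h1, ← h1']
    ring
  have := congrArg (aeval c) hfg
  rw [map_mul, map_mul, ← h2, ← h2'] at this
  refine mul_right_cancel₀ (mul_ne_zero hg hg') ?_
  linear_combination this

theorem add (h : Specializes a c x x') (h' : Specializes a c y y') :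
    Specializes a c (x + y) (x' + y') := by
  obtain ⟨f, g, hg, h1, h2⟩ := h
  obtain ⟨f', g', hg', h1', h2'⟩ := h'
  refine ⟨f * g' + f' * g, g * g', ?_, ?_, ?_⟩
  · rw [map_mul]; exact mul_ne_zero hg hg'
  · simp only [map_add, map_mul, ← h1, ← h1']; ring
  · simp only [map_add, map_mul, ← h2, ← h2']; ring

theorem mul (h : Specializes a c x x') (h' : Specializes a c y y') :
    Specializes a c (x * y) (x' * y') := by
  obtain ⟨f, g, hg, h1, h2⟩ := h
  obtain ⟨f', g', hg', h1', h2'⟩ := h'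
  refine ⟨f * f', g * g', ?_, ?_, ?_⟩
  · rw [map_mul]; exact mul_ne_zero hg hg'
  · simp only [map_mul, ← h1, ← h1']; ring
  · simp only [map_mul, ← h2, ← h2']; ring

theorem neg (h : Specializes a c x x') : Specializes a c (-x) (-x') := by
  obtain ⟨f, g, hg, h1, h2⟩ := h
  exact ⟨-f, g, hg, by rw [map_neg, neg_mul, h1], by rw [map_neg, neg_mul, h2]⟩

theorem inv (ha : AlgebraicIndependent ℤ a) (h : Specializes a c x x') (hx : x' ≠ 0) :
    Specializes a c x⁻¹ x'⁻¹ := by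
  obtain ⟨f, g, hg, h1, h2⟩ := h
  have hf : aeval c f ≠ 0 := h2 ▸ mul_ne_zero hx hg
  have hx0 : x ≠ 0 := by
    rintro rfl
    have : f = 0 := ha (by rw [← h1, zero_mul, map_zero])
    exact hf (by rw [this, map_zero])
  exact ⟨g, f, hf, by rw [← h1, inv_mul_cancel_left₀ hx0],
    by rw [← h2, inv_mul_cancel_left₀ hx]⟩

variable (a c)

theorem var (w : W) : Specializes a c (a w) (c w) := ⟨X w, 1, by simp, by simp, by simp⟩

theorem one : Specializes a c 1 1 := ⟨1, 1, by simp, by simp, by simp⟩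

theorem zero : Specializes a c 0 0 := ⟨0, 1, by simp, by simp, by simp⟩

variable {a c}

theorem pow (h : Specializes a c x x') (n : ℕ) : Specializes a c (x ^ n) (x' ^ n) := by
  induction n with
  | zero => simpa using one a c
  | succ n ih => rw [pow_succ, pow_succ]; exact ih.mul h

theorem prod {ι : Type*} {s : Finset ι} {u : ι → K} {u' : ι → F}
    (h : ∀ i ∈ s, Specializes a c (u i) (u' i)) :
    Specializes a c (∏ i ∈ s, u i) (∏ i ∈ s, u' i) := by
  classical
  induction s using Finset.induction_on with
  | empty => simpa using one a c
  | insert i s hi ih =>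
    rw [Finset.prod_insert hi, Finset.prod_insert hi]
    exact (h i (Finset.mem_insert_self i s)).mul
      (ih fun j hj => h j (Finset.mem_insert_of_mem hj))

theorem mon [Fintype W] (n : W → ℕ) : Specializes a c (mon a n) (mon c n) :=
  prod fun w _ => (var a c w).pow _

/-- Laurent polynomials can be evaluated at points with nonzero coordinates. -/
theorem exists_of_mem_ring (ha : AlgebraicIndependent ℤ a) (hc : ∀ w, c w ≠ 0) (hx : x ∈ ring a) :
    ∃ x' ∈ ring c, Specializes a c x x' := by
  induction hx using Subring.closure_induction with
  | mem x hx =>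
    rcases hx with ⟨w, rfl⟩ | ⟨w, rfl⟩
    · exact ⟨c w, mem_ring c w, var a c w⟩
    · exact ⟨_, inv_mem_ring c w, (var a c w).inv ha (hc w)⟩
  | zero => exact ⟨0, Subring.zero_mem _, zero a c⟩
  | one => exact ⟨1, Subring.one_mem _, one a c⟩
  | add x y _ _ h h' =>
    obtain ⟨x', hx', h⟩ := h
    obtain ⟨y', hy', h'⟩ := h'
    exact ⟨_, Subring.add_mem _ hx' hy', h.add h'⟩
  | neg x _ h =>
    obtain ⟨x', hx', h⟩ := h
    exact ⟨_, Subring.neg_mem _ hx', h.neg⟩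
  | mul x y _ _ h h' =>
    obtain ⟨x', hx', h⟩ := h
    obtain ⟨y', hy', h'⟩ := h'
    exact ⟨_, Subring.mul_mem _ hx' hy', h.mul h'⟩

end Specializes

end Specialization

end Laurent

/-! ### The Laurent phenomenon -/

namespace Seed

open Laurent

/-! ### Primality of the new variable in the presence of an auxiliary vertex -/

section Step

variable {W K : Type*} [Field K]

/-- Elements of the Laurent ring vanishing at a point where `z` vanishes are multiples of `z`. -/
theorem exists_eq_mul_of_specializes_zero {a : W → K} (ha : AlgebraicIndependent ℤ a) {c : W → K}
    (hc : ∀ w, c w ≠ 0) {z : K}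
    (hgen : ∀ w, c w ∈ ring a ∧ (c w)⁻¹ ∈ ring a ∧ (∃ h ∈ ring a, a w = c w + z * h) ∧
      ∃ h ∈ ring a, (a w)⁻¹ = (c w)⁻¹ + z * h) {g : K} (hg : g ∈ ring a)
    (hg0 : Specializes a c g 0) : ∃ h ∈ ring a, g = z * h := by
  -- Every Laurent polynomial is congruent modulo `z` to its value at `c`: true on generators by
  -- `hgen`, and stable under ring operations.
  have key : ∃ g0 ∈ ring a, ∃ h ∈ ring a, g = g0 + z * h ∧ Specializes a c g g0 := by
    clear hg0
    induction hg using Subring.closure_induction with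
    | mem x hx =>
      rcases hx with ⟨w, rfl⟩ | ⟨w, rfl⟩
      · obtain ⟨h1, h2, ⟨h, hh, e⟩, -⟩ := hgen w
        exact ⟨c w, h1, h, hh, e, .var a c w⟩
      · obtain ⟨h1, h2, -, ⟨h, hh, e⟩⟩ := hgen w
        exact ⟨_, h2, h, hh, e, (Specializes.var a c w).inv ha (hc w)⟩
    | zero => exact ⟨0, Subring.zero_mem _, 0, Subring.zero_mem _, by simp, .zero a c⟩
    | one => exact ⟨1, Subring.one_mem _, 0, Subring.zero_mem _, by simp, .one a c⟩
    | add x y _ _ hx hy =>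
      obtain ⟨x0, hx0, h, hh, e, hs⟩ := hx
      obtain ⟨y0, hy0, h', hh', e', hs'⟩ := hy
      exact ⟨x0 + y0, Subring.add_mem _ hx0 hy0, h + h', Subring.add_mem _ hh hh',
        by linear_combination e + e', hs.add hs'⟩
    | neg x _ hx =>
      obtain ⟨x0, hx0, h, hh, e, hs⟩ := hx
      exact ⟨-x0, Subring.neg_mem _ hx0, -h, Subring.neg_mem _ hh, by linear_combination -e, hs.neg⟩
    | mul x y hx' hy' hx hy =>
      obtain ⟨x0, hx0, h, hh, e, hs⟩ := hx
      obtain ⟨y0, hy0, h', hh', e', hs'⟩ := hy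
      exact ⟨x0 * y0, Subring.mul_mem _ hx0 hy0, x0 * h' + h * y,
        Subring.add_mem _ (Subring.mul_mem _ hx0 hh') (Subring.mul_mem _ hh hy'),
        by linear_combination y * e + x0 * e', hs.mul hs'⟩
  obtain ⟨g0, -, h, hh, e, hs⟩ := key
  rw [hs.unique ha hg0, zero_add] at e
  exact ⟨h, hh, e⟩

variable [Fintype W]

theorem posProd_eq_mon (s : Seed W K) (k : W) :
    s.posProd k = mon s.cluster fun w => (s.quiver.arrows k w).toNat := rfl

theorem negProd_eq_mon (s : Seed W K) (k : W) :
    s.negProd k = mon s.cluster fun w => (-s.quiver.arrows k w).toNat := rfl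

variable [DecidableEq W]

theorem mutate_cluster_mem (s : Seed W K) (k v : W) : (s.mutate k).cluster v ∈ ring s.cluster := by
  by_cases hv : v = k
  · subst hv
    rw [mutate_cluster_self]
    exact Subring.mul_mem _ (Subring.add_mem _ (mon_mem_ring _ _) (mon_mem_ring _ _))
      (inv_mem_ring _ _)
  · rw [mutate_cluster_of_ne _ hv]
    exact mem_ring _ _

/-- The situation of a cluster with a frozen variable `y` which occurs only in the exchange relation
of `i`, seen from the seed `s`. -/
structure Step (s : Seed W K) (i j y : W) : Prop where
  indep : AlgebraicIndependent ℤ s.cluster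
  ne : j ≠ i
  ne_y : y ≠ i
  ne_y' : y ≠ j
  arrow_y : s.quiver.arrows i y = 1
  arrow_y' : s.quiver.arrows j y = 0
  nonneg : 0 ≤ s.quiver.arrows i j

namespace Step

variable {s : Seed W K} {i j y : W}

/-- A point with value zero for the cluster variable obtained by mutation at `i`. -/
def point (i y : W) (w : W) : ℚ := if w = i then 2 else if w = y then -1 else 1

theorem point_ne_zero {W : Type*} [DecidableEq W] (i y w : W) : point i y w ≠ 0 := by
  unfold point; split_ifs <;> norm_num

theorem mon_point (h : y ≠ i) (n : W → ℕ) : mon (point i y) n = 2 ^ n i * (-1) ^ n y := by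
  rw [mon, ← Finset.mul_prod_erase _ _ (Finset.mem_univ i),
    ← Finset.mul_prod_erase _ _ (Finset.mem_erase.mpr ⟨h, Finset.mem_univ y⟩)]
  rw [Finset.prod_eq_one]
  · simp [point, h]
  · intro w hw
    simp only [Finset.mem_erase] at hw
    simp [point, hw.1, hw.2.1]

theorem nondegenerate (h : Step s i j y) : s.Nondegenerate :=
  nondegenerate_of_algebraicIndependent h.indep

/-- With no loop at `i`, and `y` occurring once in the positive product and not in the negative one,
the two products take the values -1 and 1. -/
theorem specializes_point_mutate (h : Step s i j y) :
    Specializes s.cluster (point i y) ((s.mutate i).cluster i) 0 := by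
  have h1 : Specializes s.cluster (point i y) (s.posProd i) _ := .mon _
  have h2 : Specializes s.cluster (point i y) (s.negProd i) _ := .mon _
  have h3 := (h1.add h2).mul ((Specializes.var s.cluster (point i y) i).inv h.indep
    (point_ne_zero i y i))
  rw [mutate_cluster_self]
  convert h3 using 1
  rw [mon_point h.ne_y, mon_point h.ne_y]
  simp [h.arrow_y]

/-- The point where the frozen variable is eliminated by the exchange relation of `i`. -/
def generic (s : Seed W K) (i y : W) : W → K :=
  Function.update s.cluster y (-(s.cluster y * s.negProd i / s.posProd i))

theorem generic_ne_zero (h : Step s i j y) (w : W) : generic s i y w ≠ 0 := by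
  have hs := h.nondegenerate
  unfold generic
  by_cases hw : w = y
  · subst hw
    simp [hs.ne_zero, hs.posProd_ne_zero, hs.negProd_ne_zero]
  · simp [hw, hs.ne_zero]

/-- The positive product is `p = y p₀` with `p₀` and the negative product `q` free of `y`; setting
`y` to `-q/p₀` makes `p + q` vanish. -/
theorem specializes_generic_mutate (h : Step s i j y) :
    Specializes s.cluster (generic s i y) ((s.mutate i).cluster i) 0 := by
  have hs := h.nondegenerate
  have h1 : Specializes s.cluster (generic s i y) (s.posProd i) _ := .mon _
  have h2 : Specializes s.cluster (generic s i y) (s.negProd i) _ := .mon _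
  have h3 := (h1.add h2).mul ((Specializes.var s.cluster (generic s i y) i).inv h.indep
    (generic_ne_zero h i))
  rw [mutate_cluster_self]
  convert h3 using 1
  symm
  rw [mul_eq_zero]
  left
  have hg : ∀ w ≠ y, generic s i y w = s.cluster w := fun w hw => by simp [generic, hw]
  have hgy : generic s i y y = -(s.cluster y * s.negProd i / s.posProd i) := by simp [generic]
  have hp := mon_eq_of_forall_ne (a := s.cluster) (k := y) (fun _ _ => rfl)
    (fun w => (s.quiver.arrows i w).toNat)
  have hn := mon_eq_of_forall_ne (a := s.cluster) (k := y) (fun _ _ => rfl)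
    (fun w => (-s.quiver.arrows i w).toNat)
  rw [mon_eq_of_forall_ne hg, mon_eq_of_forall_ne hg (n := fun w => (-s.quiver.arrows i w).toNat)]
  rw [← posProd_eq_mon] at hp
  rw [← negProd_eq_mon] at hn
  simp only [h.arrow_y, show (1 : ℤ).toNat = 1 from rfl, show (-1 : ℤ).toNat = 0 from rfl,
    pow_one, pow_zero, one_mul] at hp hn ⊢
  rw [← hn, hgy]
  have h0 := hs.posProd_ne_zero i
  field_simp
  rw [hp]
  ring

/-- Only `w = y` matters, where `y + y q/p = z · (y a_i/p)`, and similarly for inverses. Thus `z`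
generates the kernel of the substitution `generic`, whose values lie in a field: `z` is prime. -/
theorem generic_mem (h : Step s i j y) (w : W) :
    generic s i y w ∈ ring s.cluster ∧ (generic s i y w)⁻¹ ∈ ring s.cluster ∧
      (∃ g ∈ ring s.cluster, s.cluster w = generic s i y w + (s.mutate i).cluster i * g) ∧
      ∃ g ∈ ring s.cluster, (s.cluster w)⁻¹ = (generic s i y w)⁻¹ + (s.mutate i).cluster i * g := by
  have hs := h.nondegenerate
  by_cases hw : w = y
  · subst hw
    have hg : generic s i w w = -(s.cluster w * s.negProd i / s.posProd i) := by simp [generic]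
    have hp0 := hs.posProd_ne_zero i
    have hn0 := hs.negProd_ne_zero i
    have hw0 := hs.ne_zero w
    have hi0 := hs.ne_zero i
    have hp := mon_mem_ring s.cluster fun w => (s.quiver.arrows i w).toNat
    have hn := mon_mem_ring s.cluster fun w => (-s.quiver.arrows i w).toNat
    have hp' := inv_mon_mem_ring s.cluster fun w => (s.quiver.arrows i w).toNat
    have hn' := inv_mon_mem_ring s.cluster fun w => (-s.quiver.arrows i w).toNat
    rw [← posProd_eq_mon] at hp hp'
    rw [← negProd_eq_mon] at hn hn'
    have hw := mem_ring s.cluster w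
    have hw' := inv_mem_ring s.cluster w
    have hi := mem_ring s.cluster i
    rw [hg, mutate_cluster_self]
    refine ⟨?_, ?_, ⟨s.cluster w * s.cluster i * (s.posProd i)⁻¹, ?_, ?_⟩,
      ⟨(s.cluster w)⁻¹ * s.cluster i * (s.negProd i)⁻¹, ?_, ?_⟩⟩
    · rw [div_eq_mul_inv]
      exact Subring.neg_mem _ (Subring.mul_mem _ (Subring.mul_mem _ hw hn) hp')
    · rw [inv_neg, inv_div, div_eq_mul_inv, mul_inv]
      exact Subring.neg_mem _ (Subring.mul_mem _ hp (Subring.mul_mem _ hw' hn'))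
    · exact Subring.mul_mem _ (Subring.mul_mem _ hw hi) hp'
    · field_simp; ring
    · exact Subring.mul_mem _ (Subring.mul_mem _ hw' hi) hn'
    · field_simp; ring
  · have hg : generic s i y w = s.cluster w := by simp [generic, hw]
    rw [hg]
    exact ⟨mem_ring _ _, inv_mem_ring _ _, ⟨0, Subring.zero_mem _, by simp⟩,
      ⟨0, Subring.zero_mem _, by simp⟩⟩

/-- An element which becomes Laurent after multiplication by a power of the new cluster variable at
`i`, and after multiplication by an element coprime to it, is Laurent. -/
theorem mem_ring_of_mul_mem (h : Step s i j y) {m x : K} {m' : ℚ} (hm : m ∈ ring s.cluster)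
    (hmτ : Specializes s.cluster (point i y) m m') (hm0 : m' ≠ 0) (hxm : m * x ∈ ring s.cluster)
    {n : ℕ} (hxz : (s.mutate i).cluster i ^ n * x ∈ ring s.cluster) : x ∈ ring s.cluster := by
  have hs := h.nondegenerate
  set z := (s.mutate i).cluster i with hz
  have hz0 : z ≠ 0 := (hs.mutate i).ne_zero i
  have hdiv : ∀ g ∈ ring s.cluster, Specializes s.cluster (generic s i y) g 0 →
      ∃ g' ∈ ring s.cluster, g = z * g' := fun g hg hg0 =>
    exists_eq_mul_of_specializes_zero h.indep (generic_ne_zero h) (generic_mem h) hg hg0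
  obtain ⟨m0, -, hmm0⟩ := Specializes.exists_of_mem_ring h.indep (generic_ne_zero h) hm
  -- Otherwise `z` divides `m`, and `m` vanishes at `point` together with `z`.
  have hm00 : m0 ≠ 0 := by
    rintro rfl
    obtain ⟨g, hg, rfl⟩ := hdiv m hm hmm0
    obtain ⟨g', -, hg'⟩ := Specializes.exists_of_mem_ring h.indep (point_ne_zero i y) hg
    have := (specializes_point_mutate h).mul hg'
    rw [zero_mul] at this
    exact hm0 (hmτ.unique h.indep this)
  -- Cancel one factor `z` at a time: at `generic` the product `m * (z ^ (n + 1) * x)` vanishes but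
  -- `m` does not, so `z` divides `z ^ (n + 1) * x`.
  induction n with
  | zero => simpa using hxz
  | succ n ih =>
    refine ih ?_
    obtain ⟨g0, -, hg0⟩ := Specializes.exists_of_mem_ring h.indep (generic_ne_zero h) hxz
    have hmem : z ^ n * (m * x) ∈ ring s.cluster :=
      Subring.mul_mem _ (Subring.pow_mem _ (mutate_cluster_mem s i i) _) hxm
    obtain ⟨e, -, he⟩ := Specializes.exists_of_mem_ring h.indep (generic_ne_zero h) hmem
    have h1 := (specializes_generic_mutate h).mul he
    have h2 : m0 * g0 = 0 := by
      refine (hmm0.mul hg0).unique h.indep ?_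
      convert h1 using 1
      · rw [← hz]; ring
      · rw [zero_mul]
    have hg00 : g0 = 0 := (mul_eq_zero.mp h2).resolve_left hm00
    obtain ⟨g, hg, e⟩ := hdiv _ hxz (hg00 ▸ hg0)
    rw [pow_succ', mul_assoc] at e
    rw [mul_left_cancel₀ hz0 e]
    exact hg

end Step

end Step

end Seed

/-! ### Three consecutive mutations and the intersection of Laurent rings -/

namespace Seed

open Laurent

namespace Step

variable {W K : Type*} [Fintype W] [DecidableEq W] [Field K] {s : Seed W K} {i j y : W}

/-- The cluster variable at `j` after mutating at `i` and `j`. -/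
theorem cluster_mutate_mutate (h : Step s i j y) : ((s.mutate i).mutate j).cluster j =
    ((s.mutate i).cluster i ^ (s.quiver.arrows i j).toNat *
        mon s.cluster (Function.update
          (fun w => ((s.quiver.mutate i).arrows j w).toNat) i 0) +
      mon s.cluster (Function.update
        (fun w => (-(s.quiver.mutate i).arrows j w).toNat) i 0)) * (s.cluster j)⁻¹ := by
  have h1 : ∀ w ≠ i, (s.mutate i).cluster w = s.cluster w :=
    fun w hw => mutate_cluster_of_ne s hw
  have h2 : (-s.quiver.arrows i j).toNat = 0 := by have := h.nonneg; omega
  rw [mutate_cluster_self, posProd_eq_mon, negProd_eq_mon, mon_eq_of_forall_ne h1,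
    mon_eq_of_forall_ne h1 (fun w => (-(s.mutate i).quiver.arrows j w).toNat), h1 j h.ne]
  simp only [mutate_quiver, IceQuiver.mutate_arrows_right, h2, pow_zero, one_mul]

/-- The cluster variable at `j` after mutating at `i` and `j` is Laurent and coprime to the one
obtained by mutating at `i`. -/
theorem cluster_mutate_mutate_mem (h : Step s i j y) :
    ((s.mutate i).mutate j).cluster j ∈ ring s.cluster ∧ ∃ u' ≠ 0,
      Specializes s.cluster (point i y) (((s.mutate i).mutate j).cluster j) u' := by
  rw [cluster_mutate_mutate h]
  refine ⟨Subring.mul_mem _ (Subring.add_mem _ (Subring.mul_mem _ (Subring.pow_mem _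
    (mutate_cluster_mem s i i) _) (mon_mem_ring _ _)) (mon_mem_ring _ _)) (inv_mem_ring _ _),
    _, ?_, ((((specializes_point_mutate h).pow _).mul (.mon _)).add (.mon _)).mul
      ((Specializes.var _ _ j).inv h.indep (point_ne_zero i y j))⟩
  refine mul_ne_zero ?_ (inv_ne_zero (point_ne_zero i y j))
  rw [mon_point h.ne_y, mon_point h.ne_y]
  simp only [Function.update_self, pow_zero, one_mul, ne_eq, h.ne_y, not_false_eq_true,
    Function.update_of_ne]
  -- With arrows from `i` to `j`, the first monomial carries a factor `z` and only the second, equal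
  -- to ±1, survives. Without them, `y` stays unattached to `j` and both monomials are 1.
  by_cases hb : s.quiver.arrows i j = 0
  · have hb' : s.quiver.arrows j i = 0 := by rw [s.quiver.skew, hb, neg_zero]
    have : (s.quiver.mutate i).arrows j y = 0 := by
      rw [IceQuiver.mutate_arrows_eq]
      simp [hb, h.arrow_y', h.ne, h.ne_y]
    simp [hb, this]
  · have : (s.quiver.arrows i j).toNat ≠ 0 := by have := h.nonneg; omega
    simp [this]

/-- The exchange relation for the third mutation in the sequence `i`, `j`, `i`. -/
theorem cluster_mutate_mutate_mutate (h : Step s i j y) :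
    ∃ np nn : W → ℕ, nn i = 0 ∧ np i = 0 ∧
      (((s.mutate i).mutate j).mutate i).cluster i * (s.mutate i).cluster i =
        ((s.mutate i).mutate j).cluster j ^ (s.quiver.arrows i j).toNat * mon s.cluster np +
          mon s.cluster nn ∧
      mon s.cluster (Function.update
          (fun w => (-(s.quiver.mutate i).arrows j w).toNat) i 0) ^ (s.quiver.arrows i j).toNat *
        mon s.cluster np * s.posProd i =
      mon s.cluster nn * s.negProd i * s.cluster j ^ (s.quiver.arrows i j).toNat := by
  have hs := h.nondegenerate
  have h1 : ∀ w ≠ i, (s.mutate i).cluster w = s.cluster w :=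
    fun w hw => mutate_cluster_of_ne s hw
  have h2 : ∀ w ≠ j, ((s.mutate i).mutate j).cluster w = (s.mutate i).cluster w :=
    fun w hw => mutate_cluster_of_ne _ hw
  have h3 := cluster_mul_mutate_cluster ((hs.mutate i).mutate j) i
  rw [h2 i h.ne.symm, posProd_eq_mon, negProd_eq_mon, mon_eq_of_forall_ne h2,
    mon_eq_of_forall_ne h2 (fun w => (-((s.mutate i).mutate j).quiver.arrows i w).toNat),
    mon_eq_of_forall_ne h1, mon_eq_of_forall_ne h1 (Function.update
      (fun w => (-((s.mutate i).mutate j).quiver.arrows i w).toNat) j 0)] at h3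
  have hq : ((s.mutate i).mutate j).quiver = (s.quiver.mutate i).mutate j := rfl
  have hij : ((s.quiver.mutate i).mutate j).arrows i j = s.quiver.arrows i j := by
    rw [IceQuiver.mutate_arrows_right, IceQuiver.mutate_arrows_right]
  have h0 : (-s.quiver.arrows i j).toNat = 0 := by have := h.nonneg; omega
  have hB : ((s.quiver.arrows i j).toNat : ℤ) = s.quiver.arrows i j :=
    Int.toNat_of_nonneg h.nonneg
  simp only [hq, hij, h0, pow_zero, one_mul, Function.update_of_ne h.ne.symm,
    IceQuiver.arrows_self, Int.toNat_zero, neg_zero] at h3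
  refine ⟨_, _, ?_, ?_, (mul_comm _ _).trans h3, ?_⟩
  · simp
  · simp
  rw [posProd_eq_mon, negProd_eq_mon, ← mon_single s.cluster j, mon_pow, mon_mul, mon_mul, mon_mul, mon_mul]
  congr 1
  ext w
  simp only [Pi.add_apply, Pi.smul_apply, smul_eq_mul]
  by_cases hwi : w = i
  · subst hwi
    simp [h.ne.symm]
  by_cases hwj : w = j
  · subst hwj
    simp [hwi]
    omega
  simp only [Function.update_of_ne hwi, Function.update_of_ne hwj, Pi.single_eq_of_ne hwj]
  have hQ : ((s.quiver.mutate i).mutate j).arrows i w = -s.quiver.arrows i w -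
      ((s.quiver.arrows i j).toNat * (-(s.quiver.mutate i).arrows j w).toNat : ℕ) := by
    rw [IceQuiver.mutate_arrows_eq, IceQuiver.mutate_arrows_left, IceQuiver.mutate_arrows_right, h0]
    simp [h.ne.symm, hwj]
    ring
  rw [hQ]
  generalize (s.quiver.arrows i j).toNat * (-(s.quiver.mutate i).arrows j w).toNat = X
  omega

/-- The cluster variable at `i` after mutating at `i`, `j` and `i` is Laurent and coprime to the one
obtained by mutating at `i`. -/
theorem cluster_mutate_mutate_mutate_mem (h : Step s i j y) :
    (((s.mutate i).mutate j).mutate i).cluster i ∈ ring s.cluster ∧ ∃ v' ≠ 0,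
      Specializes s.cluster (point i y) ((((s.mutate i).mutate j).mutate i).cluster i) v' := by
  have hs := h.nondegenerate
  obtain ⟨np, nn, hnn, hnp, h1, h2⟩ := cluster_mutate_mutate_mutate h
  have hu := cluster_mutate_mutate h
  set v := (((s.mutate i).mutate j).mutate i).cluster i
  set u := ((s.mutate i).mutate j).cluster j with hudef
  set z := (s.mutate i).cluster i with hz
  set B := (s.quiver.arrows i j).toNat
  set mp := mon s.cluster (Function.update
    (fun w => ((s.quiver.mutate i).arrows j w).toNat) i 0) with hmp
  set mn := mon s.cluster (Function.update
    (fun w => (-(s.quiver.mutate i).arrows j w).toNat) i 0) with hmn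
  have hz0 : z ≠ 0 := (hs.mutate i).ne_zero i
  have hzi : z * s.cluster i = s.posProd i + s.negProd i := by
    rw [mul_comm]; exact cluster_mul_mutate_cluster hs i
  have hj0 := hs.ne_zero j
  have hp0 := hs.posProd_ne_zero i
  have hzm : z ∈ ring s.cluster := mutate_cluster_mem s i i
  have hum : u ∈ ring s.cluster := (cluster_mutate_mutate_mem h).1
  have hjm := inv_mem_ring s.cluster j
  have hmpm : mp ∈ ring s.cluster := mon_mem_ring _ _
  have hmnm : mn ∈ ring s.cluster := mon_mem_ring _ _
  -- The value of `u` at `z = 0` is `mn / a_j` when `B > 0`, and `u - mn / a_j = z ^ B * mp / a_j`.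
  -- Factoring the difference of `B`-th powers will allow division of `v * z` by `z`.
  obtain ⟨G, hGm, hG, hG0, hG1⟩ : ∃ G ∈ ring s.cluster, u ^ B - (mn * (s.cluster j)⁻¹) ^ B =
      G * (u - mn * (s.cluster j)⁻¹) ∧ (B = 0 → G = 0) ∧
        (B = 1 → G = 1) := by
    refine ⟨_, ?_, ((Commute.all _ _).geom_sum₂_mul B).symm, ?_, ?_⟩
    · exact Subring.sum_mem _ fun k _ => Subring.mul_mem _ (Subring.pow_mem _ hum _)
        (Subring.pow_mem _ (Subring.mul_mem _ hmnm hjm) _)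
    · intro hB
      rw [hB]
      simp
    · intro hB
      rw [hB]
      simp
  have hv : v * z = z * (mon s.cluster nn * s.cluster i * (s.posProd i)⁻¹) +
      (z ^ B * mp * (s.cluster j)⁻¹ * mon s.cluster np * G) := by
    -- Replacing `u` by `mn / a_j` turns the first exchange term into `nn q/p`; added to `nn` it
    -- becomes `nn (p + q)/p`, a multiple of `z`.
    have e1 : (mn * (s.cluster j)⁻¹) ^ B * mon s.cluster np =
        mon s.cluster nn * s.negProd i * (s.posProd i)⁻¹ := by
      rw [mul_pow, inv_pow]
      field_simp
      linear_combination h2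
    have e2 : u - mn * (s.cluster j)⁻¹ = z ^ B * mp * (s.cluster j)⁻¹ := by rw [hu]; ring
    rw [e2] at hG
    have e3 : mon s.cluster nn * (z * s.cluster i) * (s.posProd i)⁻¹ =
        mon s.cluster nn + mon s.cluster nn * s.negProd i * (s.posProd i)⁻¹ := by
      rw [hzi]; field_simp
    rw [h1]
    linear_combination mon s.cluster np * hG + e1 - e3
  -- The remainder in `v` is zero for `B = 0`, a Laurent monomial of value ±1 for `B = 1`, and
  -- divisible by `z` for `B ≥ 2`.
  obtain ⟨R, hRm, hR, r, hRr, hr⟩ : ∃ R ∈ ring s.cluster,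
      z * R = z ^ B * mp * (s.cluster j)⁻¹ * mon s.cluster np * G ∧
      ∃ r, Specializes s.cluster (point i y) R r ∧ (r = 0 ∨ r = 1 ∨ r = -1) := by
    rcases hB : B with _ | k
    · exact ⟨0, Subring.zero_mem _, by rw [hG0 hB]; ring, 0, .zero _ _, .inl rfl⟩
    have hrest : mp * (s.cluster j)⁻¹ * mon s.cluster np * G ∈ ring s.cluster :=
      Subring.mul_mem _ (Subring.mul_mem _ (Subring.mul_mem _ hmpm hjm) (mon_mem_ring _ _)) hGm
    refine ⟨z ^ k * (mp * (s.cluster j)⁻¹ * mon s.cluster np * G),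
      Subring.mul_mem _ (Subring.pow_mem _ hzm _) hrest, by ring, ?_⟩
    rcases k with _ | k
    · rw [hG1 hB, pow_zero, one_mul, mul_one]
      refine ⟨_, ((Specializes.mon _).mul ((Specializes.var _ _ j).inv h.indep
        (point_ne_zero i y j))).mul (.mon _), .inr ?_⟩
      rw [mon_point h.ne_y, mon_point h.ne_y, hnp]
      simp only [Function.update_self, pow_zero, one_mul, point, if_neg h.ne, if_neg h.ne_y'.symm,
        inv_one, mul_one, ← pow_add]
      exact neg_one_pow_eq_or ℚ _
    · obtain ⟨e, -, he⟩ := Specializes.exists_of_mem_ring h.indep (point_ne_zero i y) hrest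
      refine ⟨0, ?_, .inl rfl⟩
      have := ((specializes_point_mutate h).pow (k + 1)).mul he
      rwa [zero_pow k.succ_ne_zero, zero_mul] at this
  have hv' : v = mon s.cluster nn * s.cluster i * (s.posProd i)⁻¹ + R := by
    refine mul_right_cancel₀ hz0 ?_
    rw [hv, ← hR]
    ring
  have hpm : (s.posProd i)⁻¹ ∈ ring s.cluster := inv_mon_mem_ring _ _
  have hp : Specializes s.cluster (point i y) (s.posProd i) (-1) := by
    have : Specializes s.cluster (point i y) (s.posProd i) _ := .mon _
    rw [mon_point h.ne_y] at this
    simpa [h.arrow_y] using this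
  rw [hv']
  refine ⟨Subring.add_mem _ (Subring.mul_mem _ (Subring.mul_mem _ (mon_mem_ring _ _)
    (mem_ring _ _)) hpm) hRm, _, ?_, (((Specializes.mon nn).mul (.var _ _ i)).mul
    (hp.inv h.indep (by norm_num))).add hRr⟩
  rw [mon_point h.ne_y, hnn]
  simp only [point, if_true, pow_zero, one_mul]
  -- This is why `point` has the value 2 at `i`: the first summand is ±2 and `r` cannot cancel it.
  rcases neg_one_pow_eq_or ℚ (nn y) with e | e <;> rw [e] <;>
    rcases hr with rfl | rfl | rfl <;> norm_num

/-- The Laurent rings of the seeds obtained by mutating at `i`, and at `i`, `j` and `i`, meet inside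
the Laurent ring of the original seed. -/
theorem mem_ring_of_mem_of_mem (h : Step s i j y) {x : K} (h1 : x ∈ ring (s.mutate i).cluster)
    (h3 : x ∈ ring (((s.mutate i).mutate j).mutate i).cluster) : x ∈ ring s.cluster := by
  have hs := h.nondegenerate
  obtain ⟨hum, u', hu0, hu⟩ := cluster_mutate_mutate_mem h
  obtain ⟨hvm, v', hv0, hv⟩ := cluster_mutate_mutate_mutate_mem h
  have hzm := mutate_cluster_mem s i i
  have hz0 := (hs.mutate i).ne_zero i
  have hun := ((hs.mutate i).mutate j).ne_zero j
  have hvn := (((hs.mutate i).mutate j).mutate i).ne_zero i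
  have hcl1 : ∀ w ≠ i, (s.mutate i).cluster w = s.cluster w :=
    fun w hw => mutate_cluster_of_ne s hw
  have hcl2 : ∀ w ≠ j, ((s.mutate i).mutate j).cluster w = (s.mutate i).cluster w :=
    fun w hw => mutate_cluster_of_ne _ hw
  have hcl3 : ∀ w ≠ i, (((s.mutate i).mutate j).mutate i).cluster w =
    ((s.mutate i).mutate j).cluster w := fun w hw => mutate_cluster_of_ne _ hw
  set u := ((s.mutate i).mutate j).cluster j
  set v := (((s.mutate i).mutate j).mutate i).cluster i
  set z := (s.mutate i).cluster i
  have hle1 : ring (s.mutate i).cluster ≤ (ring s.cluster).away z hzm := by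
    refine Subring.closure_le.mpr ?_
    rintro _ (⟨w, rfl⟩ | ⟨w, rfl⟩)
    · exact Subring.le_away hzm (mutate_cluster_mem s i w)
    · by_cases hw : w = i
      · subst hw
        exact ⟨1, by rw [pow_one, mul_inv_cancel₀ hz0]; exact Subring.one_mem _⟩
      · simp only [hcl1 w hw]
        exact Subring.le_away hzm (inv_mem_ring _ _)
  have huvm : u * v ∈ ring s.cluster := Subring.mul_mem _ hum hvm
  have hle3 : ring (((s.mutate i).mutate j).mutate i).cluster ≤
      (ring s.cluster).away (u * v) huvm := by
    refine Subring.closure_le.mpr ?_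
    rintro _ (⟨w, rfl⟩ | ⟨w, rfl⟩)
    · refine Subring.le_away huvm ?_
      by_cases hw : w = i
      · subst hw; exact hvm
      rw [hcl3 w hw]
      by_cases hw' : w = j
      · subst hw'; exact hum
      rw [hcl2 w hw', hcl1 w hw]
      exact mem_ring _ _
    · by_cases hw : w = i
      · subst hw
        refine ⟨1, ?_⟩
        rw [pow_one, mul_inv_cancel_right₀ hvn]
        exact hum
      simp only [hcl3 w hw]
      by_cases hw' : w = j
      · subst hw'
        refine ⟨1, ?_⟩
        rw [pow_one, mul_comm u v, mul_inv_cancel_right₀ hun]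
        exact hvm
      rw [hcl2 w hw', hcl1 w hw]
      exact Subring.le_away huvm (inv_mem_ring _ _)
  obtain ⟨n, hn⟩ := hle1 h1
  obtain ⟨m, hm⟩ := hle3 h3
  exact mem_ring_of_mul_mem h (Subring.pow_mem _ huvm m) ((hu.mul hv).pow m)
    (pow_ne_zero _ (mul_ne_zero hu0 hv0)) hm hn

end Step

end Seed

/-! ### Opposite quivers, the auxiliary vertex and the Laurent phenomenon -/

namespace IceQuiver

variable {V : Type*}

/-- The opposite quiver. -/
def op (Q : IceQuiver V) : IceQuiver V where
  arrows i j := -Q.arrows i j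
  skew i j := by rw [Q.skew i j]
  frozen := Q.frozen

theorem op_arrows (Q : IceQuiver V) (i j : V) : Q.op.arrows i j = -Q.arrows i j := rfl

variable [DecidableEq V]

theorem op_mutate (Q : IceQuiver V) (k : V) : Q.op.mutate k = (Q.mutate k).op := by
  ext i j
  · simp only [op_arrows, mutate_arrows_eq, neg_neg]
    split_ifs <;> ring
  · rfl

/-- The quiver with an extra vertex joined to the vertex `i` only. -/
def extend (Q : IceQuiver V) (i : V) : IceQuiver (Option V) where
  arrows
    | some v, some w => Q.arrows v w
    | some v, none => if v = i then 1 else 0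
    | none, some w => if w = i then -1 else 0
    | none, none => 0
  skew v w := by
    rcases v with _ | v <;> rcases w with _ | w
    · simp
    · simp only; split_ifs <;> simp
    · simp only; split_ifs <;> simp
    · exact Q.skew v w
  frozen := ∅

end IceQuiver

namespace Seed

open Laurent

section Opposite

variable {V K : Type*}

/-- The seed with the opposite quiver. -/
def op (s : Seed V K) : Seed V K where
  quiver := s.quiver.op
  cluster := s.cluster

variable [Fintype V] [DecidableEq V] [Field K]

theorem op_mutate (s : Seed V K) (k : V) : s.op.mutate k = (s.mutate k).op := by
  refine congrArg₂ Seed.mk (s.quiver.op_mutate k) ?_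
  ext i
  simp only [op, IceQuiver.op_arrows, neg_neg, mutate]
  rw [add_comm]

theorem op_mutateList (s : Seed V K) (l : List V) : s.op.mutateList l = (s.mutateList l).op := by
  induction l generalizing s with
  | nil => rfl
  | cons k l ih => rw [mutateList_cons, mutateList_cons, op_mutate, ih]

theorem Nondegenerate.op {s : Seed V K} (hs : s.Nondegenerate) : s.op.Nondegenerate := by
  intro l v
  rw [op_mutateList]
  exact hs l v

end Opposite

section Lift

variable {V K K' : Type*} [Fintype V] [DecidableEq V] [Field K] [Field K']

/-- The seed `s` is obtained from the seed `s'`, which has an extra vertex, by specializing the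
initial cluster `a` to the values `c`. -/
structure IsLift (a : Option V → K') (c : Option V → K) (s' : Seed (Option V) K') (s : Seed V K) :
    Prop where
  arrows_eq : ∀ v w, s'.quiver.arrows (some v) (some w) = s.quiver.arrows v w
  cluster_none : Specializes a c (s'.cluster none) 1
  cluster_some : ∀ v, Specializes a c (s'.cluster (some v)) (s.cluster v)

variable {a : Option V → K'} {c : Option V → K} {s' : Seed (Option V) K'} {s : Seed V K}

/-- Whatever arrows the extra vertex acquires, its variable specializes to 1 and contributes a
factor 1 to the exchange relations. -/
theorem IsLift.mutate (ha : AlgebraicIndependent ℤ a) (h : IsLift a c s' s) {k : V}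
    (hk : s.cluster k ≠ 0) : IsLift a c (s'.mutate (some k)) (s.mutate k) where
  arrows_eq v w := by
    rw [mutate_quiver, mutate_quiver, IceQuiver.mutate_arrows_eq, IceQuiver.mutate_arrows_eq]
    simp only [h.arrows_eq, Option.some.injEq]
  cluster_none := by
    rw [mutate_cluster_of_ne _ (by simp)]
    exact h.cluster_none
  cluster_some v := by
    have hprod : ∀ n : Option V → ℕ, ∀ m : V → ℕ, (∀ v, n (some v) = m v) →
        Specializes a c (∏ j, s'.cluster j ^ n j) (∏ j, s.cluster j ^ m j) := by
      intro n m hnm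
      rw [Fintype.prod_option, ← one_mul (∏ j, s.cluster j ^ m j)]
      refine .mul ?_ (.prod fun v _ => ?_)
      · simpa using h.cluster_none.pow (n none)
      · rw [hnm]
        exact (h.cluster_some v).pow _
    by_cases hv : v = k
    · subst hv
      rw [mutate_cluster_self, mutate_cluster_self]
      refine .mul (.add (hprod _ _ fun w => ?_) (hprod _ _ fun w => ?_)) ((h.cluster_some v).inv ha hk)
      · rw [h.arrows_eq]
      · rw [h.arrows_eq]
    · rw [mutate_cluster_of_ne _ (by simpa using hv), mutate_cluster_of_ne _ hv]
      exact h.cluster_some v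

theorem IsLift.mutateList (ha : AlgebraicIndependent ℤ a) (h : IsLift a c s' s)
    (hs : s.Nondegenerate) (l : List V) :
    IsLift a c (s'.mutateList (l.map some)) (s.mutateList l) := by
  induction l generalizing s s' with
  | nil => exact h
  | cons k l ih => exact ih (h.mutate ha (hs.ne_zero k)) (hs.mutate k)

end Lift

theorem algebraicIndependent_of_injective {W K : Type*} [CommRing K] (f : MvPolynomial W ℤ →+* K)
    (hf : Function.Injective f) : AlgebraicIndependent ℤ fun w => f (MvPolynomial.X w) := by
  have h : (MvPolynomial.aeval fun w => f (MvPolynomial.X w) : MvPolynomial W ℤ →ₐ[ℤ] K) =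
      f.toIntAlgHom := MvPolynomial.algHom_ext fun w => MvPolynomial.aeval_X _ w
  rw [algebraicIndependent_iff_injective_aeval, h]
  exact hf

theorem exists_field_algebraicIndependent (W : Type u) :
    ∃ (K : Type u) (_ : Field K) (a : W → K), AlgebraicIndependent ℤ a :=
  ⟨FractionRing (MvPolynomial W ℤ), inferInstance, _, algebraicIndependent_of_injective
    (algebraMap (MvPolynomial W ℤ) (FractionRing (MvPolynomial W ℤ)))
    (IsFractionRing.injective _ _)⟩

/-- The Laurent phenomenon: cluster variables are Laurent polynomials in any cluster. -/
theorem Nondegenerate.mutateList_cluster_mem_ring {V K : Type u} [Fintype V] [DecidableEq V]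
    [Field K] {s : Seed V K} (hs : s.Nondegenerate) (l : List V) (v : V) :
    (s.mutateList l).cluster v ∈ ring s.cluster := by
  obtain ⟨n, hn⟩ : ∃ n, n = l.length := ⟨_, rfl⟩
  -- The vertex set and field vary because the induction hypothesis is applied to seeds on `Option
  -- V`.
  induction n using Nat.strong_induction_on generalizing V K with
  | _ n ih =>
  match l, hn with
  | [], _ => exact mem_ring _ _
  | [k], _ => exact mutate_cluster_mem s k v
  | i :: j :: l, hn =>
    simp only [List.length_cons] at hn
    by_cases hij : j = i
    · subst hij
      rw [mutateList_cons, mutateList_cons, hs.mutate_mutate]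
      exact ih l.length (by omega) hs l v rfl
    · wlog hb : 0 ≤ s.quiver.arrows i j generalizing s with H
      · have := H hs.op (by
          change 0 ≤ -s.quiver.arrows i j
          omega)
        rwa [Seed.op_mutateList] at this
      obtain ⟨K', _, a, ha⟩ := exists_field_algebraicIndependent (Option V)
      let s' : Seed (Option V) K' := ⟨s.quiver.extend i, a⟩
      have hs' : s'.Nondegenerate := nondegenerate_of_algebraicIndependent ha
      have hstep : Step s' (some i) (some j) none :=
        { indep := ha
          ne := by simpa using hij
          ne_y := by simp
          ne_y' := by simp
          arrow_y := by simp [s', IceQuiver.extend]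
          arrow_y' := by simp [s', IceQuiver.extend, hij]
          nonneg := hb }
      let c : Option V → K := fun w => w.elim 1 s.cluster
      have hc : ∀ w, c w ≠ 0 := by
        rintro (_ | w)
        · exact one_ne_zero
        · exact hs.ne_zero w
      have hlift : IsLift a c s' s :=
        ⟨fun _ _ => rfl, .var a c none, fun v => .var a c (some v)⟩
      have hmem : (s'.mutateList ((i :: j :: l).map some)).cluster (some v) ∈ ring a := by
        refine hstep.mem_ring_of_mem_of_mem ?_ ?_
        · exact ih (l.length + 1) (by omega) (hs'.mutate (some i)) ((j :: l).map some) (some v)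
            (by simp)
        -- The list `i :: l` first undoes the third mutation, so it reaches the same seed and is one
        -- shorter than the original list.
        · have h2 := (hs'.mutate (some i)).mutate (some j)
          have := ih (l.length + 1) (by omega) (h2.mutate (some i)) ((i :: l).map some) (some v)
            (by simp)
          rw [List.map_cons, mutateList_cons, h2.mutate_mutate] at this
          exact this
      obtain ⟨x', hx', hx⟩ := Specializes.exists_of_mem_ring ha hc hmem
      have := ((hlift.mutateList ha hs (i :: j :: l)).cluster_some v).unique ha hx
      rw [this]
      refine (Subring.closure_le.mpr ?_ : ring c ≤ ring s.cluster) hx'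
      rintro _ (⟨_ | w, rfl⟩ | ⟨_ | w, rfl⟩)
      · exact Subring.one_mem _
      · exact mem_ring _ _
      · change (1 : K)⁻¹ ∈ _
        rw [inv_one]
        exact Subring.one_mem _
      · exact inv_mem_ring _ _

/-- Mutations are involutions, so every seed equivalent to `s` is also reached from `t`; frozen
variables never change. -/
theorem MutationEquivalent.clusterAlgebra_le_laurentRing {V K : Type u} [Fintype V] [DecidableEq V]
    [Field K] {s t : Seed V K} (h : s.MutationEquivalent t) (hs : s.Nondegenerate) :
    s.clusterAlgebra ≤ t.laurentRing := by
  have hrev : ∃ l, s = t.mutateList l := by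
    induction h with
    | refl => exact ⟨[], rfl⟩
    | tail h' h ih =>
      obtain ⟨k, -, rfl⟩ := h
      obtain ⟨l, hl⟩ := ih
      refine ⟨k :: l, ?_⟩
      rw [mutateList_cons, (MutationEquivalent.nondegenerate h' hs).mutate_mutate, hl]
  obtain ⟨l, hl⟩ := hrev
  have ht := h.nondegenerate hs
  refine Subring.closure_le.mpr ?_
  rintro _ (⟨t', h', v, rfl⟩ | ⟨v, hv, rfl⟩)
  · obtain ⟨l', rfl⟩ := h'.exists_mutateList
    have : s.mutateList l' = t.mutateList (l ++ l') := by
      rw [hl, mutateList, mutateList, mutateList, List.foldl_append]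
    rw [this]
    exact ht.mutateList_cluster_mem_ring _ v
  · rw [← h.cluster_eq hv]
    exact inv_mem_ring _ _

end Seed

/-! ### Local acyclicity -/

namespace IceQuiver

variable {V : Type*} [Fintype V]

/-- In an acyclic quiver with exchange relations, there are no arrows between the vertices whose
variables lie in a given prime ideal. -/
theorem IsAcyclic.arrows_eq_zero {Q : IceQuiver V} (hQ : Q.IsAcyclic) {R : Type*} [CommRing R]
    {P : Ideal R} (hP : P.IsPrime) {x : V → R}
    (hx : ∀ k ∉ Q.frozen, ∃ x', x k * x' =
      ∏ j, x j ^ (Q.arrows k j).toNat + ∏ j, x j ^ (-Q.arrows k j).toNat)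
    (hfrozen : ∀ k ∈ Q.frozen, x k ∉ P) {i j : V} (hi : x i ∈ P) (hj : x j ∈ P) :
    Q.arrows i j = 0 := by
  have hmut : ∀ k, x k ∈ P → k ∉ Q.frozen := fun k hk hk' => hfrozen k hk' hk
  let T : Set V := {l | x l ∈ P ∧ ∃ k, x k ∈ P ∧ 0 < Q.arrows k l}
  have hT : ∀ l, l ∉ T := by
    intro l hl
    -- The order is reversed: a minimal element of `T` reaches no element of `T`.
    let r : V → V → Prop := fun a b => Relation.TransGen Q.MutableArrow b a
    have _ : IsTrans V r := ⟨fun a b c h h' => Relation.TransGen.trans h' h⟩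
    have _ : Std.Irrefl r := ⟨hQ⟩
    have hwf : WellFounded r := Finite.wellFounded_of_trans_of_irrefl r
    obtain ⟨m, ⟨hmP, k, hkP, hkm⟩, hmin⟩ := hwf.has_min T ⟨l, hl⟩
    have hout : ∀ w, 0 < Q.arrows m w → x w ∉ P := fun w hw hwP =>
      hmin w ⟨hwP, m, hmP, hw⟩ (.single ⟨hmut m hmP, hmut w hwP, hw⟩)
    obtain ⟨x', hx'⟩ := hx m (hmut m hmP)
    have hneg : ∏ j, x j ^ (-Q.arrows m j).toNat ∈ P := by
      refine P.mem_of_dvd (Finset.dvd_prod_of_mem _ (Finset.mem_univ k)) ?_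
      refine P.pow_mem_of_mem hkP _ ?_
      have := Q.skew k m
      omega
    -- Since `x m` and the incoming product lie in `P`, so does the outgoing product, hence the
    -- variable at some head of an arrow out of `m`, against minimality.
    have hpos : ∏ j, x j ^ (Q.arrows m j).toNat ∈ P := by
      have := hx' ▸ P.mul_mem_right x' hmP
      exact (P.add_mem_iff_left hneg).mp this
    obtain ⟨w, -, hw⟩ := hP.prod_mem_iff.mp hpos
    by_cases hw0 : 0 < Q.arrows m w
    · exact hout w hw0 (hP.mem_of_pow_mem _ hw)
    · rw [Int.toNat_of_nonpos (by omega), pow_zero] at hw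
      exact hP.one_notMem hw
  rcases lt_trichotomy (Q.arrows i j) 0 with h | h | h
  · refine absurd ⟨hi, j, hj, ?_⟩ (hT i)
    have := Q.skew i j
    omega
  · exact h
  · exact absurd ⟨hj, i, hi, h⟩ (hT j)

end IceQuiver

namespace TwoForm

open KaehlerDifferential

/-- The contribution of an exchange relation to the Weil–Petersson form. -/
theorem wedge_dlog_eq {K : Type*} [Field K] {a b p q : K} (ha : a ≠ 0) (hp : p ≠ 0)
    (hq : q ≠ 0) (h : a * b = p + q) :
    wedge K (dlog a) (dlog p - dlog q) = (q * p⁻¹) • dd a (b * q⁻¹) := by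
  have h1 : dlog p - dlog q = dlog (p * q⁻¹) := by
    rw [dlog_mul hp (inv_ne_zero hq), dlog_inv hq, sub_eq_add_neg]
  have h2 : p * q⁻¹ = a * (b * q⁻¹) - 1 := by
    field_simp
    linear_combination -h
  -- The constant 1 has no differential, the `da` term dies against `dlog a`, and the factor `a` of
  -- the other term cancels the pole.
  have h3 : D ℤ K (p * q⁻¹) = a • D ℤ K (b * q⁻¹) + (b * q⁻¹) • D ℤ K a := by
    rw [h2, map_sub, Derivation.leibniz]
    simp
  rw [h1, dlog, dlog, h3]
  simp only [map_smul, map_add, LinearMap.smul_apply, wedge_self, smul_zero, add_zero, smul_smul,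
    ← dd_eq_wedge]
  congr 1
  field_simp

end TwoForm

theorem TwoForm.pullback_subtype_inclusion {K : Type*} [CommRing K] {R S : Subring K} (h : R ≤ S)
    (η : TwoForm R) :
    pullback S.subtype (pullback (Subring.inclusion h) η) = pullback R.subtype η :=
  pullback_comp _ _ η

theorem Subring.notMem_comap_inclusion {K : Type*} [CommRing K] {R S : Subring K} (h : R ≤ S)
    {P : PrimeSpectrum S} {f : R} (hf : Subring.inclusion h f ∉ P.asIdeal) :
    f ∉ (PrimeSpectrum.comap (Subring.inclusion h) P).asIdeal := hf

namespace Seed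

section Local

variable {V K : Type*} [Fintype V] [DecidableEq V] [Field K]

/-- The Weil–Petersson form is regular where all cluster variables are invertible except for those
at a set of vertices without arrows between them. -/
theorem weilPeterssonField_mem_formsOver {s : Seed V K} (hs : s.Nondegenerate) {S : Finset V}
    (hS : ∀ i ∈ S, ∀ j ∈ S, s.quiver.arrows i j = 0) {R : Subring K}
    (hmem : ∀ v, s.cluster v ∈ R) (hmut : ∀ i ∈ S, (s.mutate i).cluster i ∈ R)
    (hinv : ∀ v ∉ S, (s.cluster v)⁻¹ ∈ R) : s.weilPeterssonField ∈ TwoForm.formsOver R := by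
  have hprod : ∀ n : V → ℕ, ∏ j, s.cluster j ^ n j ∈ R :=
    fun n => R.prod_mem fun j _ => R.pow_mem (hmem j) _
  have hprod' : ∀ n : V → ℕ, (∀ j ∈ S, n j = 0) → (∏ j, s.cluster j ^ n j)⁻¹ ∈ R := by
    intro n hn
    rw [← Finset.prod_inv_distrib]
    refine R.prod_mem fun j _ => ?_
    by_cases hj : j ∈ S
    · simp [hn j hj, R.one_mem]
    · rw [← inv_pow]
      exact R.pow_mem (hinv j hj) _
  have hrow : ∀ i ∈ S, ∑ j, s.quiver.arrows i j •
      TwoForm.wedge K (dlog (s.cluster i)) (dlog (s.cluster j)) ∈ TwoForm.formsOver R := by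
    intro i hi
    have e : ∑ j, s.quiver.arrows i j •
        TwoForm.wedge K (dlog (s.cluster i)) (dlog (s.cluster j)) =
        TwoForm.wedge K (dlog (s.cluster i)) (dlog (s.posProd i) - dlog (s.negProd i)) := by
      rw [dlog_posProd_sub_dlog_negProd hs, map_sum]
      simp only [map_zsmul]
    rw [e, TwoForm.wedge_dlog_eq (hs.ne_zero i) (hs.posProd_ne_zero i) (hs.negProd_ne_zero i)
      (cluster_mul_mutate_cluster hs i)]
    -- Without arrows inside `S`, both exchange monomials involve only invertible variables.
    have hp : (s.posProd i)⁻¹ ∈ R := hprod' _ fun j hj => by simp [hS i hi j hj]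
    have hn : (s.negProd i)⁻¹ ∈ R := hprod' _ fun j hj => by simp [hS i hi j hj]
    exact TwoForm.smul_mem_formsOver (R.mul_mem (hprod _) hp)
      (TwoForm.dd_mem_formsOver (hmem i) (R.mul_mem (hmut i hi) hn))
  rw [weilPeterssonField, ← Finset.sum_add_sum_compl S]
  refine AddSubgroup.add_mem _ (AddSubgroup.sum_mem _ hrow) ?_
  rw [Finset.sum_comm]
  refine AddSubgroup.sum_mem _ fun j _ => ?_
  by_cases hj : j ∈ S
  -- By antisymmetry the column of `j` is its row, whose entries inside `S` vanish.
  · convert hrow j hj using 1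
    rw [← Finset.sum_add_sum_compl S (fun i => s.quiver.arrows j i • _), Finset.sum_eq_zero
      (s := S) (fun i hi => by rw [hS j hj i hi, zero_smul]), zero_add]
    refine Finset.sum_congr rfl fun i _ => ?_
    rw [s.quiver.skew, TwoForm.wedge_swap, neg_smul_neg]
  · refine AddSubgroup.sum_mem _ fun i hi => AddSubgroup.zsmul_mem _ ?_ _
    have hi' : i ∉ S := Finset.mem_compl.mp hi
    simp only [dlog, map_smul, LinearMap.smul_apply, ← TwoForm.dd_eq_wedge]
    exact TwoForm.smul_mem_formsOver (hinv j hj) (TwoForm.smul_mem_formsOver (hinv i hi')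
      (TwoForm.dd_mem_formsOver (hmem i) (hmem j)))

theorem cluster_mem_clusterAlgebra {s t : Seed V K} (h : s.MutationEquivalent t) (v : V) :
    t.cluster v ∈ s.clusterAlgebra := Subring.subset_closure (Or.inl ⟨t, h, v, rfl⟩)

/-- Freezing only restricts the allowed mutations. Hence the acyclic seed of a chart is a frozen
seed of the original algebra and its variables lie there, so the denominator `f` can be chosen in
that algebra. -/
theorem MutationEquivalent.of_freeze {t r : Seed V K} {S : Finset V}
    (h : (t.freeze S).MutationEquivalent r) : ∃ t', t.MutationEquivalent t' ∧ r = t'.freeze S := by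
  induction h with
  | refl => exact ⟨t, .refl, rfl⟩
  | tail _ h ih =>
    obtain ⟨t', h', rfl⟩ := ih
    obtain ⟨k, hk, rfl⟩ := h
    exact ⟨t'.mutate k, h'.tail ⟨k, fun hk' => hk (Finset.mem_union_left _ hk'), rfl⟩, rfl⟩

theorem Nondegenerate.freeze {t : Seed V K} (ht : t.Nondegenerate) (S : Finset V) :
    (t.freeze S).Nondegenerate := by
  intro l v
  have : ∀ (l : List V) (t : Seed V K), (t.freeze S).mutateList l = (t.mutateList l).freeze S := by
    intro l
    induction l with
    | nil => exact fun _ => rfl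
    | cons k l ih => exact fun t => ih (t.mutate k)
  rw [this]
  exact ht l v

theorem MutationEquivalent.cluster_notMem_of_frozen {s r : Seed V K} (h : s.MutationEquivalent r)
    (hs : s.Nondegenerate) {P : Ideal s.clusterAlgebra} (hP : P.IsPrime) {k : V}
    (hk : k ∈ r.quiver.frozen) : ⟨r.cluster k, cluster_mem_clusterAlgebra h k⟩ ∉ P := by
  intro hkP
  rw [h.frozen_eq] at hk
  have hinv : (r.cluster k)⁻¹ ∈ s.clusterAlgebra :=
    Subring.subset_closure (Or.inr ⟨k, hk, by rw [h.cluster_eq hk]⟩)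
  refine hP.one_notMem ?_
  have h1 : (⟨r.cluster k, cluster_mem_clusterAlgebra h k⟩ * ⟨_, hinv⟩ : s.clusterAlgebra) = 1 :=
    Subtype.ext (mul_inv_cancel₀ ((h.nondegenerate hs).ne_zero k))
  rw [← h1]
  exact P.mul_mem_right _ hkP

theorem MutationEquivalent.arrows_eq_zero_of_mem {s r : Seed V K} (h : s.MutationEquivalent r)
    (hs : s.Nondegenerate) (hr : r.quiver.IsAcyclic) {P : Ideal s.clusterAlgebra} (hP : P.IsPrime)
    {i j : V} (hi : ⟨r.cluster i, cluster_mem_clusterAlgebra h i⟩ ∈ P)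
    (hj : ⟨r.cluster j, cluster_mem_clusterAlgebra h j⟩ ∈ P) : r.quiver.arrows i j = 0 := by
  refine hr.arrows_eq_zero hP (x := fun v => ⟨r.cluster v, cluster_mem_clusterAlgebra h v⟩)
    (fun k hk => ⟨⟨_, cluster_mem_clusterAlgebra (h.tail ⟨k, hk, rfl⟩) k⟩, ?_⟩)
    (fun k hk => h.cluster_notMem_of_frozen hs hP hk) hi hj
  refine Subtype.ext ?_
  simp only [Subring.coe_mul, Subring.coe_add, SubmonoidClass.coe_finsetProd,
    SubmonoidClass.coe_pow]
  exact cluster_mul_mutate_cluster (h.nondegenerate hs) k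

/-- The Weil–Petersson form is regular on the locus where the cluster variables at the complement of
a set of mutable vertices without arrows between them are invertible. -/
theorem MutationEquivalent.weilPeterssonField_mem_away {s t : Seed V K}
    (h : s.MutationEquivalent t) (hs : s.Nondegenerate) {S : Finset V}
    (hS : ∀ i ∈ S, ∀ j ∈ S, t.quiver.arrows i j = 0) (hfrozen : ∀ i ∈ S, i ∉ t.quiver.frozen)
    {f : K} (hf : f = ∏ v ∈ Sᶜ, t.cluster v) (hfA : f ∈ s.clusterAlgebra) :
    s.weilPeterssonField ∈ TwoForm.formsOver (s.clusterAlgebra.away f hfA) := by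
  have ht := h.nondegenerate hs
  rw [← h.weilPeterssonField_eq hs]
  refine weilPeterssonField_mem_formsOver ht hS
    (fun v => Subring.le_away _ (cluster_mem_clusterAlgebra h v)) (fun i hi => Subring.le_away _
      (cluster_mem_clusterAlgebra (h.tail ⟨i, hfrozen i hi, rfl⟩) i)) (fun v hv => ?_)
  refine Subring.mem_away.mpr ⟨1, ?_⟩
  rw [hf, ← Finset.mul_prod_erase _ _ (Finset.mem_compl.mpr hv), pow_one, mul_comm, ← mul_assoc,
    inv_mul_cancel₀ (ht.ne_zero v), one_mul]
  exact Subring.prod_mem _ fun w _ => cluster_mem_clusterAlgebra h w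

/-- Around every point of the spectrum of an acyclic cluster localization, the Weil–Petersson form
is regular. -/
theorem exists_weilPeterssonField_mem_away {s s' : Seed V K} (hs : s.Nondegenerate)
    (hloc : s.IsClusterLocalization s') (hac : s'.IsAcyclic)
    (hle : s.clusterAlgebra ≤ s'.clusterAlgebra) {P : Ideal s'.clusterAlgebra} (hP : P.IsPrime) :
    ∃ f : s.clusterAlgebra, Subring.inclusion hle f ∉ P ∧
      s.weilPeterssonField ∈ TwoForm.formsOver (s.clusterAlgebra.away f f.2) := by
  classical
  obtain ⟨⟨t, hst, S₀, -, rfl⟩, -⟩ := hloc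
  obtain ⟨r, hr, hracyc⟩ := hac
  obtain ⟨t', htt', rfl⟩ := hr.of_freeze
  have hst' : s.MutationEquivalent t' := hst.trans htt'
  have hs' := (hst.nondegenerate hs).freeze S₀
  -- The variables vanishing at the point; `f` is the product of the others.
  let S : Finset V := {v | ⟨t'.cluster v, cluster_mem_clusterAlgebra hr v⟩ ∈ P}
  have hSP : ∀ v, v ∈ S ↔ ⟨t'.cluster v, cluster_mem_clusterAlgebra hr v⟩ ∈ P := fun v => by
    simp [S]
  clear_value S
  let x : V → s.clusterAlgebra := fun v => ⟨t'.cluster v, cluster_mem_clusterAlgebra hst' v⟩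
  refine ⟨∏ v ∈ Sᶜ, x v, ?_, hst'.weilPeterssonField_mem_away hs (S := S) ?_ ?_ ?_ _⟩
  · intro h
    rw [map_prod] at h
    obtain ⟨v, hv, hvP⟩ := hP.prod_mem_iff.mp h
    exact Finset.mem_compl.mp hv ((hSP v).mpr hvP)
  · intro i hi j hj
    exact hr.arrows_eq_zero_of_mem hs' hracyc hP ((hSP i).mp hi) ((hSP j).mp hj)
  · intro i hi hif
    exact hr.cluster_notMem_of_frozen hs' hP (Finset.mem_union_left _ hif) ((hSP i).mp hi)
  · rw [SubmonoidClass.coe_finsetProd]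

end Local

end Seed

theorem AlgebraicIndependent.int_of_rat {V K : Type*} [Field K] [Algebra ℚ K] {a : V → K}
    (ha : AlgebraicIndependent ℚ a) : AlgebraicIndependent ℤ a :=
  ha.restrictScalars (RingHom.injective_int _)

namespace Seed

/-- The Weil–Petersson form of a locally acyclic cluster algebra extends to a 2-form on its
spectrum. -/
theorem IsLocallyAcyclic.exists_twoForm {V K : Type u} [Fintype V] [DecidableEq V] [Field K]
    {s : Seed V K} (hs : s.Nondegenerate)
    (hD : LinearIndependent K fun v => KaehlerDifferential.D ℤ K (s.cluster v))
    (hA : s.IsLocallyAcyclic) :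
    ∃ η : TwoForm s.clusterAlgebra, ∀ t : Seed V K, s.MutationEquivalent t →
      ∃ h : s.clusterAlgebra ≤ t.laurentRing,
        TwoForm.pullback (Subring.inclusion h) η = t.weilPetersson := by
  obtain ⟨C, -, hC, hcover⟩ := hA
  have hω : s.weilPeterssonField ∈ TwoForm.formsOver s.clusterAlgebra := by
    refine TwoForm.mem_formsOver_of_forall_prime fun P => ?_
    obtain ⟨s', hs', hle, P', rfl⟩ := hcover P
    obtain ⟨f, hfP, hf⟩ :=
      exists_weilPeterssonField_mem_away hs (hC s' hs').1 (hC s' hs').2 hle P'.isPrime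
    exact ⟨f, Subring.notMem_comap_inclusion hle hfP, hf⟩
  obtain ⟨η, hη⟩ := hω
  refine ⟨η, fun t ht => ⟨ht.clusterAlgebra_le_laurentRing hs, ?_⟩⟩
  -- Equality on the torus may be checked over `K`, where both sides are the common Weil–Petersson
  -- form.
  refine TwoForm.pullback_subtype_injective (a := t.cluster) (L := t.laurentRing)
    (ht.nondegenerate hs).ne_zero (ht.linearIndependent_D hs hD) rfl ?_
  rw [TwoForm.pullback_subtype_inclusion, pullback_weilPetersson, ht.weilPeterssonField_eq hs, hη]

end Seed

end

theorem theorem4p3 {V : Type*} [Fintype V] [DecidableEq V]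
    (s : Seed V (RationalFunctions V)) (hs : AlgebraicIndependent ℚ s.cluster)
    (hA : s.IsLocallyAcyclic) :
    ∃ η : TwoForm s.clusterAlgebra,
      ∀ t : Seed V (RationalFunctions V), s.MutationEquivalent t →
        ∃ h : s.clusterAlgebra ≤ t.laurentRing,
          TwoForm.pullback (Subring.inclusion h) η = t.weilPetersson := by
  have hnd : s.Nondegenerate := Seed.nondegenerate_of_algebraicIndependent hs.int_of_rat
  have hD := hs.isTranscendenceBasis_rationalFunctions.linearIndependent_D
  exact hA.exists_twoForm hnd hD
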